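/- **Setting.** Let $n,q,k,L$ be positive integers and let $\{\mathcal V_b\}_{b=1}^q$ be a partition of $[n]$ into $q$ blocks of equal length $k=n/q\ge 1$. Let $\{\mathcal P_i\}_{i=1}^L$ be a partition of the set of blocks $[q]$ into $L$ nonempty sets, let $\omega_1,\dots,\omega_L\ge 0$, and put $w=\sum_{i=1}^L\omega_i 1_{\mathcal P_i}\in\mathbb R_+^q$ and $$\|z\|_{1,2,w}=\sum_{b=1}^q w_b\|z_{\mathcal V_b}\|_2\qquad(z\in\mathbb R^n).$$ Let $x\in\mathbb R^n$ have block support $\mathcal B=\{b\in[q]:\|x_{\mathcal V_b}\|_2\neq 0\}$, block sparsity $s=|\mathcal B|$, accuracies $\alpha_i=|\mathcal P_i\cap\mathcal B|/|\mathcal P_i|$ and relative sizes $\rho_i=|\mathcal P_i|/q$ (so $s=\sum_{i=1}^L\alpha_i\rho_i q$). For $f:\mathbb R^n\to\mathbb R$ convex, let $\mathcal D(f,x)=\bigcup_{t>0}\{z\in\mathbb R^n: f(x+tz)\le f(x)\}$ be its descent cone at $x$. For a convex cone $\mathcal C\subseteq\mathbb R^n$ with polar $\mathcal C^\circ=\{y:\langle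 y,z\rangle\le 0\ \ \forall z\in\mathcal C\}$, let $\delta(\mathcal C)=\mathbb E\,\mathrm{dist}^2(g,\mathcal C^\circ)$ be its statistical dimension, where $g$ is a standard Gaussian vector in $\mathbb R^n$. The normalized number of Gaussian linear measurements required by weighted $\ell_{1,2}$ minimization ($\min\|z\|_{1,2,w}$ subject to $Az=Ax$) is defined as $$m_{q,s,w}:=\frac{\delta\big(\mathcal D(\|\cdot\|_{1,2,w},x)\big)}{q}.$$ With $\phi_B(z)=\int_z^\infty (u-z)^2u^{k-1}e^{-u^2/2}\,du$, put $$\hat m_{q,s,w}:=\inf_{t\ge 0}\ \sum_{i=1}^L\rho_i\Big(\alpha_i\,(k+t^2\omega_i^2)+\frac{1-\alpha_i}{2^{\frac k2-1}\Gamma(\frac k2)}\,\phi_B(t\omega_i)\Big).$$ **Proposition.** In this setting, $$\hat m_{q,s,w}-\frac{2}{\sqrt{qL}}\ \le\ m_{q,s,w}\ \le\ \hat m_{q,s,w}.$$ -/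

import Mathlib

open MeasureTheory

namespace BlockSparse

noncomputable section

/-! ### Conic geometry in `ℝⁿ` -/

/-- Descent cone of `f` at `x`: the directions from `x` along which `f` does not increase for at
least one positive step size. -/
def descentCone {n : ℕ} (f : EuclideanSpace ℝ (Fin n) → ℝ) (x : EuclideanSpace ℝ (Fin n)) :
    Set (EuclideanSpace ℝ (Fin n)) :=
  {z | ∃ t : ℝ, 0 < t ∧ f (x + t • z) ≤ f x}

/-- Polar cone `C° = {y : ⟨y, z⟩ ≤ 0 for all z ∈ C}`. -/
def polarCone {n : ℕ} (C : Set (EuclideanSpace ℝ (Fin n))) : Set (EuclideanSpace ℝ (Fin n)) :=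
  {y | ∀ z ∈ C, inner ℝ y z ≤ 0}

/-- Statistical dimension `δ(C) = E dist²(g, C°)` of a convex cone `C ⊆ ℝⁿ`, where `g` is a
standard Gaussian vector in `ℝⁿ`. -/
def statDim {n : ℕ} (C : Set (EuclideanSpace ℝ (Fin n))) : ℝ :=
  ∫ g, (Metric.infDist g (polarCone C)) ^ 2
    ∂(ProbabilityTheory.stdGaussian (EuclideanSpace ℝ (Fin n)))

/-! ### Blocks and partitions -/

/-- The finite sets `P i` form a partition of `α`: they are nonempty, pairwise disjoint and
cover `α`. -/
def IsPartitionOf {ι α : Type*} (P : ι → Finset α) : Prop :=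
  (∀ i, (P i).Nonempty) ∧ (∀ i j, i ≠ j → Disjoint (P i) (P j)) ∧ ∀ a, ∃ i, a ∈ P i

/-- The Euclidean norm `‖x_V‖₂` of the subvector of `x` indexed by `V`. -/
def blockNorm {n : ℕ} (V : Finset (Fin n)) (x : EuclideanSpace ℝ (Fin n)) : ℝ :=
  Real.sqrt (∑ j ∈ V, (x j) ^ 2)

/-- The weighted norm `‖z‖_{1,2,w} = ∑_b w_b ‖z_{V_b}‖₂`. -/
def weightedL12 {n q : ℕ} (V : Fin q → Finset (Fin n)) (w : Fin q → ℝ)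
    (z : EuclideanSpace ℝ (Fin n)) : ℝ :=
  ∑ b, w b * blockNorm (V b) z

open Classical in
/-- Block support: the indices of the blocks of `x` with nonzero `ℓ₂` norm. -/
def blockSupport {n q : ℕ} (V : Fin q → Finset (Fin n)) (x : EuclideanSpace ℝ (Fin n)) :
    Finset (Fin q) :=
  Finset.univ.filter fun b => blockNorm (V b) x ≠ 0

/-- The weight vector `w = ∑_i ω_i 1_{P_i}` on the `q` blocks. -/
def blockWeights {q L : ℕ} (P : Fin L → Finset (Fin q)) (ω : Fin L → ℝ) (b : Fin q) : ℝ :=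
  ∑ i, if b ∈ P i then ω i else 0

/-- Accuracy `α_i = |P_i ∩ B| / |P_i|`. -/
def accuracy {q L : ℕ} (P : Fin L → Finset (Fin q)) (B : Finset (Fin q)) (i : Fin L) : ℝ :=
  ((P i ∩ B).card : ℝ) / ((P i).card : ℝ)

/-- Relative size `ρ_i = |P_i| / q`. -/
def relativeSize {q L : ℕ} (P : Fin L → Finset (Fin q)) (i : Fin L) : ℝ :=
  ((P i).card : ℝ) / (q : ℝ)

/-! ### The measurement number and its explicit upper bound -/

/-- Normalized number of Gaussian measurements for weighted `ℓ_{1,2}` minimization: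
`m_{q,s,w} = δ(D(‖·‖_{1,2,w}, x)) / q`. -/
def measurementNumber {n q : ℕ} (V : Fin q → Finset (Fin n)) (w : Fin q → ℝ)
    (x : EuclideanSpace ℝ (Fin n)) : ℝ :=
  statDim (descentCone (weightedL12 V w) x) / (q : ℝ)

/-- `φ_B(z) = ∫_z^∞ (u - z)² u^{k-1} exp(-u²/2) du`, for block length `k ≥ 1`. -/
def phiB (k : ℕ) (z : ℝ) : ℝ :=
  ∫ u in Set.Ioi z, (u - z) ^ 2 * u ^ (k - 1) * Real.exp (-u ^ 2 / 2)

/-- `Ψ_{t,w} = ∑_i ρ_i (α_i (k + t² ω_i²) + (1 - α_i) / (2^{k/2-1} Γ(k/2)) φ_B(t ω_i))`. -/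
def Psi {L : ℕ} (k : ℕ) (ω ρ α : Fin L → ℝ) (t : ℝ) : ℝ :=
  ∑ i, ρ i * (α i * ((k : ℝ) + t ^ 2 * ω i ^ 2) +
    (1 - α i) / ((2 : ℝ) ^ ((k : ℝ) / 2 - 1) * Real.Gamma ((k : ℝ) / 2)) * phiB k (t * ω i))

/-- The explicit bound `m̂_{q,s,w} = inf_{t ≥ 0} Ψ_{t,w}`. -/
def mHat {L : ℕ} (k : ℕ) (ω ρ α : Fin L → ℝ) : ℝ :=
  ⨅ t : {t : ℝ // 0 ≤ t}, Psi k ω ρ α t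

end

end BlockSparse

/-!
Write `B` for the block support of `x`, `w` for the weights, and `F(g, t)` for the squared distance
of a Gaussian vector `g` to `t` times the subdifferential of the weighted norm at `x`
(`subdiffDistSq`). Its mean is `q Ψ(t)` (`integral_subdiffDistSq`), by independence of the blocks of
`g` and polar coordinates in each block.

*Upper bound.* Nonnegative multiples of subgradients lie in the polar of the descent cone, so the
squared distance to the polar cone is at most `F(g, t)` for every `t ≥ 0` (`statDim_le`).

*Lower bound.* If the weighted norm does not vanish at `x`, the squared distance to the polar cone
is `min_t F(g, t) = F(g, τ)`. The optimal dilation `τ` depends on `g` only through the directional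
derivatives `z_b` of the block norms: `z_b` is the component of `g` along `x` in a block of the
support and the norm of the block of `g` otherwise. The optimality condition reads `A(z, τ) = 0`
or `τ = 0`, where `A(z, t) = ∑_{b ∈ B} w_b (z_b - t w_b) + ∑_{b ∉ B} w_b (z_b - t w_b)⁺` is
`-∂F/∂t / 2` (`dualSlope`). It is solved by a maximum of linear forms with nonnegative coefficients
`a_b` satisfying `∑ w_b a_b ≤ 1` (`dualSlope_maxLinear`). As `F` is convex in `t`, taking `t = E τ`
yields
`E F(g, t) - E F(g, τ) ≤ 2 E[A(z, t) (τ - t)] = 2 Cov(A(z, t), τ)`.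

This covariance is at most one (`integral_sum_mul_maxLinear_sub_le`). The coordinates `z_b` are
independent, so each of them can be treated with the others fixed. Since `τ` is nondecreasing in
`z_b`, replacing the soft threshold `(z_b - t w_b)⁺` by `z_b` increases the covariance, and
`Cov(z_b, τ) ≤ E ∂τ/∂z_b`, with equality in the Gaussian case and by integration by parts for chi
distributions (`HasChiDensity.steinBound`). Finally `∑ w_b ∂τ/∂z_b ≤ 1` by the condition on the
linear forms. So the statistical dimension is at least `q m̂ - 2`, and `2 / q ≤ 2 / √(q L)` because
a partition of `q` blocks has at most `q` parts.

If the weighted norm vanishes at `x`, the polar cone vanishes on every block of weight zero, and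
`F(g, t)` tends to the squared norm of these blocks of `g` as `t → ∞`.
-/

namespace BlockSparse

/-! ### A one-dimensional Stein inequality -/

open Set Filter Topology in
theorem integrableOn_pow_mul_exp (a : ℕ) :
    IntegrableOn (fun x : ℝ => x ^ a * Real.exp (-x ^ 2 / 2)) (Ioi 0) := by
  have h := integrableOn_rpow_mul_exp_neg_mul_sq (b := 1 / 2) (by norm_num) (s := (a : ℝ))
    (lt_of_lt_of_le (by norm_num) (Nat.cast_nonneg a))
  refine h.congr_fun (fun x _ => ?_) measurableSet_Ioi
  simp only [Real.rpow_natCast]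
  ring_nf

open Set Filter Topology in
theorem tendsto_pow_mul_exp_neg_sq (a : ℕ) :
    Tendsto (fun x : ℝ => x ^ a * Real.exp (-x ^ 2 / 2)) atTop (𝓝 0) := by
  refine squeeze_zero' ?_ ?_ (Real.tendsto_pow_mul_exp_neg_atTop_nhds_zero a)
  · filter_upwards [eventually_ge_atTop 0] with x hx
    positivity
  · filter_upwards [eventually_ge_atTop 2] with x hx
    gcongr
    nlinarith

theorem abs_le_of_lipschitz {T : ℝ → ℝ} {K : NNReal} (hT : LipschitzWith K T) (x : ℝ) :
    |T x| ≤ |T 0| + K * |x| := by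
  have h := hT.dist_le_mul x 0
  rw [Real.dist_eq, Real.dist_eq, sub_zero] at h
  have := abs_sub_abs_le_abs_sub (T x) (T 0)
  linarith

open Set in
theorem integrableOn_lipschitz_mul_pow_mul_exp {T : ℝ → ℝ} {K : NNReal} (hT : LipschitzWith K T)
    (a : ℕ) : IntegrableOn (fun x : ℝ => T x * (x ^ a * Real.exp (-x ^ 2 / 2))) (Ioi 0) := by
  have h := ((integrableOn_pow_mul_exp a).const_mul |T 0|).add
    ((integrableOn_pow_mul_exp (a + 1)).const_mul (K : ℝ))
  refine h.mono' (hT.continuous.mul (by fun_prop)).aestronglyMeasurable ?_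
  filter_upwards [ae_restrict_mem measurableSet_Ioi] with x hx
  have hx' : (0 : ℝ) < x := hx
  rw [Real.norm_eq_abs, abs_mul, abs_of_nonneg (a := x ^ a * _) (by positivity)]
  have := abs_le_of_lipschitz hT x
  rw [abs_of_pos hx'] at this
  calc |T x| * (x ^ a * Real.exp (-x ^ 2 / 2))
      ≤ (|T 0| + K * x) * (x ^ a * Real.exp (-x ^ 2 / 2)) := by gcongr
    _ = _ := by simp only [Pi.add_apply]; ring

/-- Integration by parts on `(0, ∞)` of a Lipschitz function against `x ^ a * exp (-x² / 2)`. -/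
theorem integral_deriv_mul_pow_mul_exp {T : ℝ → ℝ} {K : NNReal} (hT : LipschitzWith K T) (a : ℕ) :
    ∫ x in Set.Ioi (0 : ℝ), deriv T x * (x ^ a * Real.exp (-x ^ 2 / 2)) =
      -(T 0 * 0 ^ a) - ∫ x in Set.Ioi (0 : ℝ),
        T x * ((a * x ^ (a - 1) - x ^ (a + 1)) * Real.exp (-x ^ 2 / 2)) := by
  set ρ : ℝ → ℝ := fun x => x ^ a * Real.exp (-x ^ 2 / 2) with hρ
  set ρ' : ℝ → ℝ := fun x => (a * x ^ (a - 1) - x ^ (a + 1)) * Real.exp (-x ^ 2 / 2) with hρ'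
  have hder : ∀ x, HasDerivAt ρ (ρ' x) x := by
    intro x
    have h1 : HasDerivAt (fun x : ℝ => -x ^ 2 / 2) (-x) x := by
      have := ((hasDerivAt_pow 2 x).neg).div_const 2
      convert! this using 1
      simp
      ring
    convert! (hasDerivAt_pow a x).mul h1.exp using 1
    simp only [hρ']
    ring
  have hcont' : Continuous ρ' := by fun_prop
  have hderiv : deriv ρ = ρ' := funext fun x => (hder x).deriv
  have hC1 : ContDiff ℝ 1 ρ := by
    simp only [hρ]
    fun_prop
  have hintρ' : IntegrableOn (fun x => T x * ρ' x) (Set.Ioi 0) := by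
    have h := ((integrableOn_lipschitz_mul_pow_mul_exp hT (a - 1)).const_mul (a : ℝ)).sub
      (integrableOn_lipschitz_mul_pow_mul_exp hT (a + 1))
    refine IntegrableOn.congr_fun h (fun x _ => ?_) measurableSet_Ioi
    simp only [hρ', Pi.sub_apply]
    ring
  have hintρ : IntegrableOn (fun x => deriv T x * ρ x) (Set.Ioi 0) := by
    refine ((integrableOn_pow_mul_exp a).const_mul (K : ℝ)).mono'
      ((measurable_deriv T).mul hC1.continuous.measurable).aestronglyMeasurable ?_
    filter_upwards [ae_restrict_mem measurableSet_Ioi] with x hx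
    have hx' : (0 : ℝ) < x := hx
    rw [norm_mul, Real.norm_eq_abs (ρ x), abs_of_nonneg (a := ρ x) (by positivity)]
    gcongr
    exact norm_deriv_le_of_lipschitz hT
  have hfin : ∀ N : ℝ, ∫ x in (0 : ℝ)..N, deriv T x * ρ x =
      T N * ρ N - T 0 * ρ 0 - ∫ x in (0 : ℝ)..N, T x * ρ' x := by
    intro N
    have hTac : AbsolutelyContinuousOnInterval T 0 N :=
      hT.lipschitzOnWith.absolutelyContinuousOnInterval
    have hρac : AbsolutelyContinuousOnInterval ρ 0 N :=
      hC1.contDiffOn.absolutelyContinuousOnInterval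
    have := hTac.integral_mul_deriv_eq_deriv_mul hρac
    rw [hderiv] at this
    linarith
  have hlim1 := intervalIntegral_tendsto_integral_Ioi 0 hintρ Filter.tendsto_id
  have hlim2 := intervalIntegral_tendsto_integral_Ioi 0 hintρ' Filter.tendsto_id
  have hlim3 : Filter.Tendsto (fun N => T N * ρ N) Filter.atTop (nhds 0) := by
    have h := ((tendsto_pow_mul_exp_neg_sq a).const_mul |T 0|).add
      ((tendsto_pow_mul_exp_neg_sq (a + 1)).const_mul (K : ℝ))
    rw [mul_zero, mul_zero, add_zero] at h
    refine squeeze_zero_norm' ?_ h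
    filter_upwards [Filter.eventually_ge_atTop 0] with x hx
    rw [Real.norm_eq_abs, abs_mul, abs_of_nonneg (a := ρ x) (by positivity)]
    have := abs_le_of_lipschitz hT x
    rw [abs_of_nonneg hx] at this
    calc |T x| * ρ x ≤ (|T 0| + K * x) * ρ x := by gcongr
      _ = _ := by simp only [hρ]; ring
  have hlim4 : Filter.Tendsto (fun N => T N * ρ N - T 0 * ρ 0 - ∫ x in (0 : ℝ)..N, T x * ρ' x)
      Filter.atTop (nhds (0 - T 0 * ρ 0 - ∫ x in Set.Ioi 0, T x * ρ' x)) :=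
    (hlim3.sub_const _).sub hlim2
  have := tendsto_nhds_unique hlim1 (by simpa only [id, hfin] using hlim4)
  rw [this]
  simp [hρ, hρ']

/-- A probability measure on `ℝ` satisfies the Stein inequality if the covariance of the identity
with a nondecreasing Lipschitz function is at most the mean of the derivative of this function. -/
def SteinBound (μ : Measure ℝ) : Prop :=
  ∀ (T : ℝ → ℝ) (K : NNReal), LipschitzWith K T → Monotone T →
    ∫ x, (x - ∫ y, y ∂μ) * T x ∂μ ≤ ∫ x, deriv T x ∂μ

/-- `μ` has a density on `(0, ∞)` proportional to `x ^ (k - 1) * exp (-x² / 2)`, i.e. it is a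
multiple of the law of the norm of a standard Gaussian vector in dimension `k`. This is expressed
through the integrals of all measurable functions. -/
def HasChiDensity (k : ℕ) (μ : Measure ℝ) : Prop :=
  ∃ C : ℝ, 0 ≤ C ∧ ∀ h : ℝ → ℝ, Measurable h →
    ∫ x, h x ∂μ = C * ∫ x in Set.Ioi (0 : ℝ), h x * (x ^ (k - 1) * Real.exp (-x ^ 2 / 2))

theorem setIntegral_pow_mul_exp_pos (a : ℕ) :
    0 < ∫ x in Set.Ioi (0 : ℝ), x ^ a * Real.exp (-x ^ 2 / 2) := by
  refine (setIntegral_pos_iff_support_of_nonneg_ae ?_ (integrableOn_pow_mul_exp a)).2 ?_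
  · filter_upwards [ae_restrict_mem measurableSet_Ioi] with x hx
    have hx' : (0 : ℝ) < x := hx
    simp only [Pi.zero_apply]
    positivity
  · have : Set.Ioi (0 : ℝ) ⊆
        Function.support (fun x : ℝ => x ^ a * Real.exp (-x ^ 2 / 2)) ∩ Set.Ioi 0 := by
      intro x hx
      have hx' : (0 : ℝ) < x := hx
      exact ⟨by simp only [Function.mem_support]; positivity, hx⟩
    exact lt_of_lt_of_le (by simp) (measure_mono this)

/-- After integration by parts the inequality compares the integrals of `T` and of a constant
against a function with a single change of sign, at `(k - 1) / m` where `m` is the mean. -/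
theorem HasChiDensity.steinBound {k : ℕ} (hk : 1 ≤ k) {μ : Measure ℝ} [IsProbabilityMeasure μ]
    (hμ : HasChiDensity k μ) : SteinBound μ := by
  obtain ⟨C, hC, hμ⟩ := hμ
  intro T K hT hmono
  obtain ⟨a, rfl⟩ : ∃ a, k = a + 1 := ⟨k - 1, by omega⟩
  simp only [Nat.add_sub_cancel] at hμ
  set m := ∫ y, y ∂μ with hm
  set ρ : ℝ → ℝ := fun x => x ^ a * Real.exp (-x ^ 2 / 2) with hρ
  have hJ : C * ∫ x in Set.Ioi (0 : ℝ), ρ x = 1 := by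
    have := hμ (fun _ => 1) measurable_const
    simpa using this.symm
  have hm1 : C * ∫ x in Set.Ioi (0 : ℝ), x ^ (a + 1) * Real.exp (-x ^ 2 / 2) = m := by
    rw [hm, hμ (fun x => x) measurable_id]
    congr 2
    funext x
    ring
  have hCpos : 0 < C := by
    rcases hC.eq_or_lt with h | h
    · rw [← h] at hJ
      simp at hJ
    · exact h
  have hmpos : 0 < m := by
    rw [← hm1]
    exact mul_pos hCpos (setIntegral_pow_mul_exp_pos _)
  rw [hμ (fun x => (x - m) * T x) ((measurable_id.sub_const m).mul hT.continuous.measurable),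
    hμ _ (measurable_deriv T), integral_deriv_mul_pow_mul_exp hT a]
  refine mul_le_mul_of_nonneg_left ?_ hC
  set κ : ℝ → ℝ := fun x => (a * x ^ (a - 1) - m * x ^ a) * Real.exp (-x ^ 2 / 2) with hκ
  have hint : ∀ {S : ℝ → ℝ} {K : NNReal}, LipschitzWith K S →
      IntegrableOn (fun x => S x * κ x) (Set.Ioi 0) := by
    intro S K hS
    have h := ((integrableOn_lipschitz_mul_pow_mul_exp hS (a - 1)).const_mul (a : ℝ)).sub
      ((integrableOn_lipschitz_mul_pow_mul_exp hS a).const_mul m)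
    refine IntegrableOn.congr_fun h (fun x _ => ?_) measurableSet_Ioi
    simp only [hκ, Pi.sub_apply]
    ring
  have hsplit : ∀ {S : ℝ → ℝ} {K : NNReal}, LipschitzWith K S →
      ∫ x in Set.Ioi (0 : ℝ), S x * κ x =
        (∫ x in Set.Ioi (0 : ℝ), (x - m) * S x * ρ x) +
        ∫ x in Set.Ioi (0 : ℝ),
          S x * ((a * x ^ (a - 1) - x ^ (a + 1)) * Real.exp (-x ^ 2 / 2)) := by
    intro S K hS
    have h1 := integrableOn_lipschitz_mul_pow_mul_exp hS (a - 1)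
    have h2 := integrableOn_lipschitz_mul_pow_mul_exp hS a
    have h3 := integrableOn_lipschitz_mul_pow_mul_exp hS (a + 1)
    rw [← integral_add]
    · congr 1
      funext x
      simp only [hκ, hρ]
      ring
    · refine IntegrableOn.congr_fun (h3.sub (h2.const_mul m)) (fun x _ => ?_) measurableSet_Ioi
      simp only [hρ, Pi.sub_apply]
      ring
    · refine IntegrableOn.congr_fun ((h1.const_mul (a : ℝ)).sub h3) (fun x _ => ?_)
        measurableSet_Ioi
      simp only [Pi.sub_apply]
      ring
  have hone : ∫ x in Set.Ioi (0 : ℝ), κ x = -0 ^ a := by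
    have h1 := hsplit (S := fun _ => (1 : ℝ)) (K := 0) (LipschitzWith.const 1)
    have h2 := integral_deriv_mul_pow_mul_exp (T := fun _ => (1 : ℝ)) (K := 0)
      (LipschitzWith.const 1) a
    have h3 : ∫ x in Set.Ioi (0 : ℝ), (x - m) * 1 * ρ x = 0 := by
      have e : ∀ x : ℝ, (x - m) * 1 * ρ x = x ^ (a + 1) * Real.exp (-x ^ 2 / 2) - m * ρ x := by
        intro x
        simp only [hρ]
        ring
      simp only [e]
      rw [integral_sub (integrableOn_pow_mul_exp _) ((integrableOn_pow_mul_exp _).const_mul m),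
        integral_const_mul]
      have hJ' : m * (C * ∫ x in Set.Ioi (0 : ℝ), ρ x) = m := by rw [hJ, mul_one]
      have : C * ((∫ x in Set.Ioi (0 : ℝ), x ^ (a + 1) * Real.exp (-x ^ 2 / 2)) -
          m * ∫ x in Set.Ioi (0 : ℝ), ρ x) = 0 := by
        rw [mul_sub, hm1]
        linarith
      exact (mul_eq_zero.1 this).resolve_left hCpos.ne'
    simp only [deriv_const, zero_mul, integral_zero, one_mul] at h1 h2
    simp only [mul_one] at h1 h3
    rw [h1, h3]
    linarith
  -- `κ` changes sign at `y`, and `T` is nondecreasing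
  set y : ℝ := a / m with hy
  have hsign : ∫ x in Set.Ioi (0 : ℝ), T x * κ x ≤ ∫ x in Set.Ioi (0 : ℝ), T y * κ x := by
    refine setIntegral_mono_on (hint hT) (hint (LipschitzWith.const (T y))) measurableSet_Ioi ?_
    intro x hx
    have hx' : (0 : ℝ) < x := hx
    have hκx : κ x * x = (a - m * x) * ρ x := by
      simp only [hκ, hρ]
      rcases a with _ | b
      · simp
        ring
      · simp only [Nat.add_sub_cancel]
        ring
    have hρx : 0 < ρ x := by positivity
    rcases le_total x y with h | h
    · have h1 : 0 ≤ κ x := by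
        have : m * x ≤ a := by
          rw [hy, le_div_iff₀ hmpos] at h
          linarith
        have : 0 ≤ κ x * x := by rw [hκx]; exact mul_nonneg (by linarith) hρx.le
        exact nonneg_of_mul_nonneg_left this hx'
      exact mul_le_mul_of_nonneg_right (hmono h) h1
    · have h1 : κ x ≤ 0 := by
        have : a ≤ m * x := by
          rw [hy, div_le_iff₀ hmpos] at h
          linarith
        have : κ x * x ≤ 0 := by
          rw [hκx]; exact mul_nonpos_of_nonpos_of_nonneg (by linarith) hρx.le
        by_contra hcon
        push Not at hcon
        nlinarith [mul_pos hcon hx']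
      exact mul_le_mul_of_nonpos_right (hmono h) h1
  rw [hsplit hT, integral_const_mul, hone] at hsign
  -- either `a = 0` and then `y = 0`, or both sides vanish
  have h0 : T y * -0 ^ a = -(T 0 * 0 ^ a) := by
    rcases a with _ | b
    · simp [hy]
    · simp
  rw [h0] at hsign
  linarith

/-- Gaussian integration by parts, obtained from the two half-lines. -/
theorem steinBound_gaussianReal : SteinBound (ProbabilityTheory.gaussianReal 0 1) := by
  intro T K hT _
  have hT' : LipschitzWith K fun x => T (-x) := by
    have := hT.comp (LipschitzWith.id.neg (α := ℝ))
    rwa [mul_one] at this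
  have hpdf : ∀ x : ℝ, ProbabilityTheory.gaussianPDFReal 0 1 x =
      (Real.sqrt (2 * Real.pi))⁻¹ * Real.exp (-x ^ 2 / 2) := by
    intro x
    simp [ProbabilityTheory.gaussianPDFReal]
  have hsym : ∀ h : ℝ → ℝ, IntegrableOn h (Set.Ioi 0) → IntegrableOn (fun x => h (-x)) (Set.Ioi 0) →
      ∫ x, h x = (∫ x in Set.Ioi (0 : ℝ), h x) + ∫ x in Set.Ioi (0 : ℝ), h (-x) := by
    intro h h1 h2
    have h3 : IntegrableOn h (Set.Iic 0) := by
      rw [← integrableOn_Ici_iff_integrableOn_Ioi] at h2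
      have := h2.comp_neg
      simpa using this
    rw [← intervalIntegral.integral_Iic_add_Ioi h3 h1, add_comm]
    congr 1
    rw [integral_comp_neg_Ioi]
    simp
  have hmean : ∫ y, y ∂(ProbabilityTheory.gaussianReal 0 1) = 0 := by simp
  rw [hmean, ProbabilityTheory.integral_gaussianReal_eq_integral_smul one_ne_zero,
    ProbabilityTheory.integral_gaussianReal_eq_integral_smul one_ne_zero]
  simp only [hpdf, smul_eq_mul, mul_assoc]
  rw [integral_const_mul, integral_const_mul]
  refine mul_le_mul_of_nonneg_left (le_of_eq ?_) (by positivity)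
  have hd : ∀ {S : ℝ → ℝ}, LipschitzWith K S →
      IntegrableOn (fun x => Real.exp (-x ^ 2 / 2) * deriv S x) (Set.Ioi 0) := by
    intro S hS
    refine ((integrableOn_pow_mul_exp 0).const_mul (K : ℝ)).mono'
      ((by fun_prop : Measurable fun x : ℝ => Real.exp (-x ^ 2 / 2)).mul
        (measurable_deriv S)).aestronglyMeasurable (Filter.Eventually.of_forall fun x => ?_)
    rw [norm_mul, Real.norm_eq_abs (Real.exp _), abs_of_pos (Real.exp_pos _), pow_zero, one_mul,
      mul_comm]
    gcongr
    exact norm_deriv_le_of_lipschitz hS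
  have hderiv : ∀ x, deriv (fun x => T (-x)) x = -deriv T (-x) := fun x => deriv_comp_neg T x
  have hm : ∀ {S : ℝ → ℝ}, LipschitzWith K S →
      IntegrableOn (fun x => Real.exp (-x ^ 2 / 2) * (x * S x)) (Set.Ioi 0) := by
    intro S hS
    refine (integrableOn_lipschitz_mul_pow_mul_exp hS 1).congr_fun (fun x _ => ?_) measurableSet_Ioi
    simp only
    ring
  have e1 := integral_deriv_mul_pow_mul_exp hT 0
  have e2 := integral_deriv_mul_pow_mul_exp hT' 0
  rw [hsym, hsym (fun x => Real.exp (-x ^ 2 / 2) * deriv T x) (hd hT)]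
  · simp only [hderiv, pow_zero, mul_one, neg_zero, one_mul, Nat.cast_zero, zero_mul, zero_sub,
      zero_add, pow_one, neg_mul, mul_neg, integral_neg, neg_sq, sub_neg_eq_add,
      sub_zero] at e1 e2 ⊢
    have c1 : ∀ S : ℝ → ℝ, ∫ x in Set.Ioi (0 : ℝ), Real.exp (-x ^ 2 / 2) * (x * S x) =
        ∫ x in Set.Ioi (0 : ℝ), S x * (x * Real.exp (-x ^ 2 / 2)) := fun S => by
      congr 1; funext x; ring
    have c2 : ∀ S : ℝ → ℝ, ∫ x in Set.Ioi (0 : ℝ), Real.exp (-x ^ 2 / 2) * S x =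
        ∫ x in Set.Ioi (0 : ℝ), S x * Real.exp (-x ^ 2 / 2) := fun S => by
      congr 1; funext x; ring
    rw [c1 T, c1 fun x => T (-x), c2 (deriv T), c2 fun x => deriv T (-x)]
    linarith
  · have := (hd hT').neg
    refine IntegrableOn.congr_fun this (fun x _ => ?_) measurableSet_Ioi
    simp [hderiv]
  · simpa using hm hT
  · refine IntegrableOn.congr_fun (hm hT').neg (fun x _ => ?_) measurableSet_Ioi
    simp

/-! ### Covariances with a maximum of linear forms -/

/-- Soft thresholding `max (x - c) 0` only decreases the covariance with a nondecreasing function,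
since the difference `min x c` is itself nondecreasing. -/
theorem SteinBound.posPart_sub {μ : Measure ℝ} [IsProbabilityMeasure μ] (hμ : SteinBound μ)
    (h2 : MemLp (fun x : ℝ => x) 2 μ) (c : ℝ) {T : ℝ → ℝ} {K : NNReal} (hT : LipschitzWith K T)
    (hmono : Monotone T) :
    ∫ x, (max (x - c) 0 - ∫ y, max (y - c) 0 ∂μ) * T x ∂μ ≤ ∫ x, deriv T x ∂μ := by
  refine le_trans ?_ (hμ T K hT hmono)
  have hid : Integrable (fun x : ℝ => x) μ := h2.integrable one_le_two
  have hT2 : MemLp T 2 μ := by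
    refine ((memLp_const |T 0|).add ((h2.norm).const_mul (K : ℝ))).mono'
      hT.continuous.aestronglyMeasurable (Filter.Eventually.of_forall fun x => ?_)
    exact abs_le_of_lipschitz hT x
  have hmin2 : MemLp (fun x : ℝ => min x c) 2 μ :=
    ((memLp_const |c|).add h2.norm).mono' (by fun_prop)
      (Filter.Eventually.of_forall fun x => by
        simp only [Real.norm_eq_abs, Pi.add_apply]
        rcases min_choice x c with h | h <;> rw [h] <;> linarith [abs_nonneg x, abs_nonneg c])
  have hmax : ∀ x, max (x - c) 0 = x - min x c := by
    intro x
    rcases le_total x c with h | h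
    · rw [max_eq_right (by linarith), min_eq_left h, sub_self]
    · rw [max_eq_left (by linarith), min_eq_right h]
  have hmini := hmin2.integrable one_le_two
  simp only [hmax]
  rw [integral_sub hid hmini]
  set m := ∫ y, y ∂μ
  set r := ∫ y, min y c ∂μ with hr
  have hrc : r ≤ c := by
    calc r ≤ ∫ _, c ∂μ := integral_mono hmini (integrable_const _) fun x => min_le_right x c
      _ = c := by simp
  have hcov : 0 ≤ ∫ x, (min x c - r) * T x ∂μ := by
    have h1 : ∫ x, (min x c - r) * T r ∂μ = 0 := by
      rw [integral_mul_const, integral_sub hmini (integrable_const _)]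
      simp [hr]
    rw [← h1]
    -- `min x c - r` and `T x - T r` have the same sign
    refine integral_mono ((hmini.sub (integrable_const _)).mul_const _)
      ((hmin2.sub (memLp_const r)).integrable_mul hT2) fun x => ?_
    change (min x c - r) * T r ≤ (min x c - r) * T x
    rcases le_or_gt r x with h | h
    · exact mul_le_mul_of_nonneg_left (hmono h) (sub_nonneg.2 (le_min h hrc))
    · exact mul_le_mul_of_nonpos_left (hmono h.le)
        (by linarith [min_le_left x c])
  have e : ∫ x, (x - m) * T x ∂μ =
      (∫ x, (x - min x c - (m - r)) * T x ∂μ) + ∫ x, (min x c - r) * T x ∂μ := by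
    rw [← integral_add]
    · congr 1
      funext x
      ring
    · exact ((h2.sub hmin2).sub (memLp_const (m - r))).integrable_mul hT2
    · exact (hmin2.sub (memLp_const r)).integrable_mul hT2
  rw [e]
  linarith

/-- The maximum over `i` of the linear forms with coefficients `a i`. -/
noncomputable def maxLinear {ι I : Type*} [Fintype ι] (a : I → ι → ℝ) (z : ι → ℝ) : ℝ :=
  ⨆ i, ∑ b, a i b * z b

theorem le_maxLinear {ι I : Type*} [Fintype ι] [Finite I] (a : I → ι → ℝ)
    (z : ι → ℝ) (i : I) : ∑ b, a i b * z b ≤ maxLinear a z :=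
  le_ciSup (f := fun i => ∑ b, a i b * z b) (Set.finite_range _).bddAbove i

theorem exists_eq_maxLinear {ι I : Type*} [Fintype ι] [Finite I]
    [Nonempty I]
    (a : I → ι → ℝ) (z : ι → ℝ) : ∃ i, ∑ b, a i b * z b = maxLinear a z :=
  exists_eq_ciSup_of_finite

theorem maxLinear_zero {ι I : Type*} [Fintype ι] [Finite I]
    [Nonempty I]
    (a : I → ι → ℝ) : maxLinear a 0 = 0 := by
  obtain ⟨i, hi⟩ := exists_eq_maxLinear a 0
  rw [← hi]
  simp

theorem sum_mul_update {ι : Type*} [Fintype ι] [DecidableEq ι] (a z : ι → ℝ) (b : ι) (x : ℝ) :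
    ∑ c, a c * Function.update z b x c = ∑ c, a c * z c + a b * (x - z b) := by
  have h : ∀ c, a c * Function.update z b x c =
      a c * z c + if c = b then a b * (x - z b) else 0 := by
    intro c
    by_cases hc : c = b
    · subst hc
      simp
      ring
    · simp [hc]
  simp [h, Finset.sum_add_distrib]

theorem monotone_maxLinear_update {ι I : Type*} [Fintype ι] [DecidableEq ι] [Finite I]
    [Nonempty I]
    {a : I → ι → ℝ} (ha : ∀ i b, 0 ≤ a i b) (z : ι → ℝ) (b : ι) :
    Monotone fun x => maxLinear a (Function.update z b x) := by
  intro x y hxy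
  obtain ⟨i, hi⟩ := exists_eq_maxLinear a (Function.update z b x)
  change maxLinear a _ ≤ maxLinear a _
  rw [← hi]
  refine le_trans ?_ (le_maxLinear a (Function.update z b y) i)
  rw [sum_mul_update, sum_mul_update]
  have := mul_le_mul_of_nonneg_left hxy (ha i b)
  linarith

theorem maxLinear_le_add {ι I : Type*} [Fintype ι] [Finite I]
    [Nonempty I]
    {a : I → ι → ℝ} {M : ℝ} (haM : ∀ i b, |a i b| ≤ M) (z z' : ι → ℝ) :
    maxLinear a z ≤ maxLinear a z' + M * ∑ b, |z b - z' b| := by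
  obtain ⟨i, hi⟩ := exists_eq_maxLinear a z
  rw [← hi]
  have h : ∑ b, a i b * z b ≤ ∑ b, a i b * z' b + M * ∑ b, |z b - z' b| := by
    rw [Finset.mul_sum, ← Finset.sum_add_distrib]
    refine Finset.sum_le_sum fun b _ => ?_
    have h1 := le_abs_self (a i b * (z b - z' b))
    rw [abs_mul] at h1
    have h2 := mul_le_mul_of_nonneg_right (haM i b) (abs_nonneg (z b - z' b))
    nlinarith
  linarith [le_maxLinear a z' i]

theorem lipschitzWith_maxLinear_update {ι I : Type*} [Fintype ι] [DecidableEq ι] [Finite I]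
    [Nonempty I]
    {a : I → ι → ℝ} {M : NNReal} (haM : ∀ i b, |a i b| ≤ M)
    (z : ι → ℝ) (b : ι) : LipschitzWith M fun x => maxLinear a (Function.update z b x) := by
  refine LipschitzWith.of_le_add_mul M fun x y => ?_
  refine (maxLinear_le_add haM _ (Function.update z b y)).trans_eq ?_
  congr 2
  rw [Finset.sum_eq_single b]
  · simp [Real.dist_eq]
  · intro c _ hc
    simp [hc]
  · simp

theorem continuous_maxLinear {ι I : Type*} [Fintype ι] [Finite I]
    [Nonempty I]
    (a : I → ι → ℝ) : Continuous (maxLinear a) := by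
  have := Fintype.ofFinite I
  have h : maxLinear a = fun z => Finset.univ.sup' Finset.univ_nonempty
      fun i => ∑ b, a i b * z b := by
    funext z
    rw [Finset.sup'_univ_eq_ciSup, maxLinear]
  rw [h]
  exact Continuous.finset_sup'_apply _ fun i _ => by fun_prop

/-- Wherever a maximum of linear forms is partially differentiable, its derivative is the
coefficient of any form attaining the maximum; elsewhere `deriv` is `0`. Hence a weighted sum of
partial derivatives is bounded as soon as it is for each linear form. -/
theorem sum_mul_deriv_maxLinear_le {ι I : Type*} [Fintype ι] [DecidableEq ι] [Finite I]
    [Nonempty I]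
    {a : I → ι → ℝ} (ha : ∀ i b, 0 ≤ a i b) {w : ι → ℝ}
    (hw : ∀ b, 0 ≤ w b) (hwa : ∀ i, ∑ b, w b * a i b ≤ 1) (z : ι → ℝ) :
    ∑ b, w b * deriv (fun x => maxLinear a (Function.update z b x)) (z b) ≤ 1 := by
  obtain ⟨i, hi⟩ := exists_eq_maxLinear a z
  refine (Finset.sum_le_sum fun b _ => mul_le_mul_of_nonneg_left ?_ (hw b)).trans (hwa i)
  set T : ℝ → ℝ := fun x => maxLinear a (Function.update z b x) with hT
  by_cases hd : DifferentiableAt ℝ T (z b)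
  · -- `T` lies above the form `i`, with equality at `z b`
    have hmin : IsLocalMin (fun x => T x - a i b * x) (z b) := by
      refine Filter.Eventually.of_forall fun x => ?_
      have h1 := le_maxLinear a (Function.update z b x) i
      rw [sum_mul_update, hi] at h1
      simp only [hT, Function.update_eq_self]
      linarith
    have hder := hd.hasDerivAt.sub ((hasDerivAt_id (z b)).const_mul (a i b))
    have := hmin.hasDerivAt_eq_zero hder
    linarith
  · rw [deriv_zero_of_not_differentiableAt hd]
    exact ha i b

/-- Resampling one coordinate preserves a product probability measure. -/
theorem measurePreserving_update {ι : Type*} [Fintype ι] [DecidableEq ι] (μ : ι → Measure ℝ)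
    [∀ b, IsProbabilityMeasure (μ b)] (b : ι) :
    MeasurePreserving (fun p : (ι → ℝ) × ℝ => Function.update p.1 b p.2)
      ((Measure.pi μ).prod (μ b)) (Measure.pi μ) := by
  have hmeas : Measurable fun p : (ι → ℝ) × ℝ => Function.update p.1 b p.2 := by
    refine measurable_pi_lambda _ fun c => ?_
    by_cases hc : c = b
    · subst hc
      simpa using measurable_snd
    · simpa [hc, Function.comp_def] using (measurable_pi_apply c).comp measurable_fst
  refine ⟨hmeas, (Measure.pi_eq fun s hs => ?_).symm⟩
  rw [Measure.map_apply hmeas (MeasurableSet.univ_pi hs)]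
  have hset : (fun p : (ι → ℝ) × ℝ => Function.update p.1 b p.2) ⁻¹' Set.univ.pi s =
      (Set.univ.pi (Function.update s b Set.univ)) ×ˢ s b := by
    ext ⟨z, x⟩
    simp only [Set.mem_preimage, Set.mem_pi, Set.mem_univ, true_imp_iff, Set.mem_prod]
    constructor
    · intro h
      refine ⟨fun c => ?_, by simpa using h b⟩
      by_cases hc : c = b
      · subst hc; simp
      · simpa [hc] using h c
    · rintro ⟨h1, h2⟩ c
      by_cases hc : c = b
      · subst hc; simpa using h2
      · simpa [hc] using h1 c
  rw [hset, Measure.prod_prod, Measure.pi_pi, ← Finset.mul_prod_erase _ _ (Finset.mem_univ b),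
    ← Finset.mul_prod_erase _ _ (Finset.mem_univ b)]
  simp only [Function.update_self, measure_univ, one_mul]
  rw [mul_comm]
  congr 1
  refine Finset.prod_congr rfl fun c hc => ?_
  rw [Function.update_of_ne (Finset.ne_of_mem_erase hc)]

/-- Integration over a product probability space by resampling one coordinate. -/
theorem integral_update {ι : Type*} [Fintype ι] [DecidableEq ι] {μ : ι → Measure ℝ}
    [∀ b, IsProbabilityMeasure (μ b)] {G : (ι → ℝ) → ℝ} (hG : Integrable G (Measure.pi μ)) (b : ι) :
    Integrable (fun z => ∫ x, G (Function.update z b x) ∂(μ b)) (Measure.pi μ) ∧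
    ∫ z, G z ∂(Measure.pi μ) =
      ∫ z, ∫ x, G (Function.update z b x) ∂(μ b) ∂(Measure.pi μ) := by
  have hup := measurePreserving_update μ b
  have hG' : Integrable (fun p : (ι → ℝ) × ℝ => G (Function.update p.1 b p.2))
    ((Measure.pi μ).prod (μ b)) := hup.integrable_comp_of_integrable hG
  refine ⟨hG'.integral_prod_left, ?_⟩
  have h := integral_map hup.measurable.aemeasurable (f := G)
    (by rw [hup.map_eq]; exact hG.aestronglyMeasurable)
  rw [hup.map_eq] at h
  rw [h, integral_prod _ hG']

theorem exists_abs_le_nnreal {ι I : Type*} [Fintype ι] [Finite I] (a : I → ι → ℝ) :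
    ∃ M : NNReal, ∀ i b, |a i b| ≤ M := by
  obtain ⟨M, hM⟩ := (Set.finite_range fun p : I × ι => ‖a p.1 p.2‖₊).bddAbove
  exact ⟨M, fun i b => by exact_mod_cast hM ⟨(i, b), rfl⟩⟩

theorem memLp_maxLinear {ι I : Type*} [Fintype ι] [Finite I] [Nonempty I] (a : I → ι → ℝ)
    {μ : ι → Measure ℝ} [∀ b, IsProbabilityMeasure (μ b)]
    (h2 : ∀ b, MemLp (fun x : ℝ => x) 2 (μ b)) : MemLp (maxLinear a) 2 (Measure.pi μ) := by
  obtain ⟨M, haM⟩ := exists_abs_le_nnreal a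
  have hz : ∀ b, MemLp (fun z : ι → ℝ => z b) 2 (Measure.pi μ) := fun b =>
    (h2 b).comp_measurePreserving (measurePreserving_eval μ b)
  have hs : MemLp (fun z : ι → ℝ => M * ∑ b, |z b|) 2 (Measure.pi μ) :=
    (memLp_finsetSum _ fun b _ => (hz b).norm).const_mul M
  refine hs.mono' (continuous_maxLinear a).aestronglyMeasurable
    (Filter.Eventually.of_forall fun z => ?_)
  have h1 := maxLinear_le_add haM z 0
  have h2 := maxLinear_le_add haM 0 z
  simp only [maxLinear_zero, Pi.zero_apply, sub_zero, zero_sub, abs_neg, zero_add] at h1 h2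
  exact abs_le.2 ⟨by linarith, h1⟩

theorem measurable_deriv_param_coord {ι : Type*} [Fintype ι] {F : (ι → ℝ) → ℝ → ℝ}
    (hF : Continuous F.uncurry) (b : ι) : Measurable fun z : ι → ℝ => deriv (F z) (z b) := by
  have h := measurable_deriv_with_param hF
  have h' : Measurable fun z : ι → ℝ => (z, z b) := by fun_prop
  exact Measurable.comp (g := fun p : (ι → ℝ) × ℝ => deriv (F p.1) p.2) h h'

/-- If the coordinates are independent, the covariance of a function `f` of the coordinate `b` with
a maximum of linear forms is bounded by the mean partial derivative, whenever the one-dimensional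
inequality holds for `f`. -/
theorem integral_coord_mul_maxLinear_le {ι I : Type*} [Fintype ι] [DecidableEq ι] [Finite I]
    [Nonempty I]
    {a : I → ι → ℝ} (ha : ∀ i b, 0 ≤ a i b)
    {μ : ι → Measure ℝ} [∀ b, IsProbabilityMeasure (μ b)]
    (h2 : ∀ b, MemLp (fun x : ℝ => x) 2 (μ b)) (b : ι) {f : ℝ → ℝ} (hf : MemLp f 2 (μ b))
    (hstein : ∀ (T : ℝ → ℝ) (K : NNReal), LipschitzWith K T → Monotone T →
      ∫ x, (f x - ∫ y, f y ∂(μ b)) * T x ∂(μ b) ≤ ∫ x, deriv T x ∂(μ b)) :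
    Integrable (fun z : ι → ℝ => deriv (fun x => maxLinear a (Function.update z b x)) (z b))
      (Measure.pi μ) ∧
    ∫ z, (f (z b) - ∫ y, f y ∂(μ b)) * maxLinear a z ∂(Measure.pi μ) ≤
      ∫ z, deriv (fun x => maxLinear a (Function.update z b x)) (z b) ∂(Measure.pi μ) := by
  obtain ⟨M, haM⟩ := exists_abs_le_nnreal a
  have hcont : Continuous (Function.uncurry fun (z : ι → ℝ) (x : ℝ) =>
      maxLinear a (Function.update z b x)) :=
    (continuous_maxLinear a).comp (continuous_fst.update b continuous_snd)
  have hmeas : Measurable fun z : ι → ℝ =>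
      deriv (fun x => maxLinear a (Function.update z b x)) (z b) :=
    measurable_deriv_param_coord hcont b
  have hint : Integrable (fun z : ι → ℝ =>
      deriv (fun x => maxLinear a (Function.update z b x)) (z b)) (Measure.pi μ) :=
    Integrable.of_bound hmeas.aestronglyMeasurable (M : ℝ) (Filter.Eventually.of_forall fun z =>
      norm_deriv_le_of_lipschitz (lipschitzWith_maxLinear_update haM z b))
  refine ⟨hint, ?_⟩
  have hfb : MemLp (fun z : ι → ℝ => f (z b)) 2 (Measure.pi μ) :=
    hf.comp_measurePreserving (measurePreserving_eval μ b)
  have hint' : Integrable (fun z : ι → ℝ => (f (z b) - ∫ y, f y ∂(μ b)) * maxLinear a z)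
      (Measure.pi μ) := (hfb.sub (memLp_const _)).integrable_mul (memLp_maxLinear a h2)
  obtain ⟨hi, he⟩ := integral_update hint b
  obtain ⟨hi', he'⟩ := integral_update hint' b
  rw [he, he']
  refine integral_mono hi' hi fun z => ?_
  simp only [Function.update_self, Function.update_idem]
  exact hstein _ M (lipschitzWith_maxLinear_update haM z b) (monotone_maxLinear_update ha z b)

/-- The covariance of a weighted sum of functions `f b` of independent coordinates with a maximum of
linear forms is at most one, if each of the forms pairs with the weights to at most one and the
one-dimensional inequality holds for each `f b`. -/
theorem integral_sum_mul_maxLinear_sub_le {ι I : Type*} [Fintype ι] [DecidableEq ι] [Finite I]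
    [Nonempty I]
    {a : I → ι → ℝ} (ha : ∀ i b, 0 ≤ a i b) {w : ι → ℝ}
    (hw : ∀ b, 0 ≤ w b) (hwa : ∀ i, ∑ b, w b * a i b ≤ 1)
    {μ : ι → Measure ℝ} [∀ b, IsProbabilityMeasure (μ b)]
    (h2 : ∀ b, MemLp (fun x : ℝ => x) 2 (μ b)) {f : ι → ℝ → ℝ} (hf : ∀ b, MemLp (f b) 2 (μ b))
    (hstein : ∀ (b : ι) (T : ℝ → ℝ) (K : NNReal), LipschitzWith K T → Monotone T →
      ∫ x, (f b x - ∫ y, f b y ∂(μ b)) * T x ∂(μ b) ≤ ∫ x, deriv T x ∂(μ b)) :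
    ∫ z, (∑ b, w b * f b (z b)) * (maxLinear a z - ∫ y, maxLinear a y ∂(Measure.pi μ))
      ∂(Measure.pi μ) ≤ 1 := by
  set τ := maxLinear a
  have hτ : MemLp τ 2 (Measure.pi μ) := memLp_maxLinear a h2
  have hτi : Integrable τ (Measure.pi μ) := hτ.integrable one_le_two
  have hfb : ∀ b, MemLp (fun z : ι → ℝ => f b (z b)) 2 (Measure.pi μ) := fun b =>
    (hf b).comp_measurePreserving (measurePreserving_eval μ b)
  have hmean : ∀ b, ∫ z, f b (z b) ∂(Measure.pi μ) = ∫ y, f b y ∂(μ b) := fun b => by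
    have h := integral_map (μ := Measure.pi μ) (measurable_pi_apply b).aemeasurable (f := f b)
      (by rw [(measurePreserving_eval μ b).map_eq]; exact (hf b).aestronglyMeasurable)
    rw [(measurePreserving_eval μ b).map_eq] at h
    exact h.symm
  have hprod : ∀ b, Integrable (fun z : ι → ℝ => f b (z b) * τ z) (Measure.pi μ) := fun b =>
    (hfb b).integrable_mul hτ
  have hcoord := fun b => integral_coord_mul_maxLinear_le ha h2 b (hf b) (hstein b)
  have e1 : ∀ b, ∫ z, f b (z b) * (τ z - ∫ y, τ y ∂(Measure.pi μ)) ∂(Measure.pi μ) =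
      ∫ z, (f b (z b) - ∫ y, f b y ∂(μ b)) * τ z ∂(Measure.pi μ) := by
    intro b
    simp only [mul_sub, sub_mul]
    rw [integral_sub (hprod b) (((hfb b).integrable one_le_two).mul_const _),
      integral_sub (hprod b) (hτi.const_mul _), integral_mul_const, integral_const_mul, hmean]
  calc ∫ z, (∑ b, w b * f b (z b)) * (τ z - ∫ y, τ y ∂(Measure.pi μ)) ∂(Measure.pi μ)
      = ∑ b, w b * ∫ z, (f b (z b) - ∫ y, f b y ∂(μ b)) * τ z ∂(Measure.pi μ) := by
        simp only [Finset.sum_mul, mul_assoc]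
        rw [integral_finsetSum]
        · refine Finset.sum_congr rfl fun b _ => ?_
          rw [integral_const_mul, e1]
        · intro b _
          exact ((hfb b).integrable_mul (hτ.sub (memLp_const _))).const_mul _
    _ ≤ ∑ b, w b * ∫ z, deriv (fun x => τ (Function.update z b x)) (z b) ∂(Measure.pi μ) :=
        Finset.sum_le_sum fun b _ => mul_le_mul_of_nonneg_left (hcoord b).2 (hw b)
    _ = ∫ z, ∑ b, w b * deriv (fun x => τ (Function.update z b x)) (z b) ∂(Measure.pi μ) := by
        rw [integral_finsetSum _ fun b _ => (hcoord b).1.const_mul _]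
        simp only [integral_const_mul, τ]
    _ ≤ ∫ _, 1 ∂(Measure.pi μ) :=
        integral_mono (integrable_finsetSum _ fun b _ => (hcoord b).1.const_mul _)
          (integrable_const _) fun z => sum_mul_deriv_maxLinear_le ha hw hwa z
    _ = 1 := by simp

/-! ### Subdifferential of a norm at a point -/

section NormDeriv

variable {E : Type*} [NormedAddCommGroup E] [InnerProductSpace ℝ E]

open Classical in
/-- One-sided directional derivative of the norm at `x` in direction `z`. -/
noncomputable def normDeriv (x z : E) : ℝ := if x = 0 then ‖z‖ else inner ℝ x z / ‖x‖

open Classical in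
/-- The residual of `g` after projecting it onto `c` times the subdifferential of the norm at `x`:
this subdifferential is the unit ball if `x = 0` and the unit vector of `x` otherwise. -/
noncomputable def normResidual (x g : E) (c : ℝ) : E :=
  if x = 0 then max 0 (1 - c / ‖g‖) • g else g - (c / ‖x‖) • x

theorem normDeriv_le_norm_add_sub (x z : E) : normDeriv x z ≤ ‖x + z‖ - ‖x‖ := by
  unfold normDeriv
  split_ifs with hx
  · simp [hx]
  · have hx' : 0 < ‖x‖ := norm_pos_iff.2 hx
    rw [div_le_iff₀ hx']
    have h := real_inner_le_norm x (x + z)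
    rw [inner_add_right, real_inner_self_eq_norm_sq] at h
    linarith

theorem norm_add_smul_le (x z : E) : ∃ K : ℝ, 0 ≤ K ∧ ∀ s : ℝ, 0 ≤ s →
    ‖x + s • z‖ ≤ ‖x‖ + s * normDeriv x z + s ^ 2 * K := by
  by_cases hx : x = 0
  · refine ⟨0, le_rfl, fun s hs => ?_⟩
    simp [normDeriv, hx, norm_smul, abs_of_nonneg hs]
  · have hx' : 0 < ‖x‖ := norm_pos_iff.2 hx
    refine ⟨‖z‖ ^ 2 / (2 * ‖x‖), by positivity, fun s hs => ?_⟩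
    have h1 : ‖x + s • z‖ ^ 2 = ‖x‖ ^ 2 + 2 * (s * inner ℝ x z) + s ^ 2 * ‖z‖ ^ 2 := by
      rw [norm_add_sq_real, inner_smul_right, norm_smul, mul_pow, Real.norm_eq_abs, sq_abs]
    -- the tangent line bound `2 ‖x‖ ‖y‖ ≤ ‖x‖² + ‖y‖²` for the square root
    have h2 : 2 * ‖x‖ * ‖x + s • z‖ ≤ ‖x‖ ^ 2 + ‖x + s • z‖ ^ 2 := two_mul_le_add_sq _ _
    have h3 : ‖x‖ + s * normDeriv x z + s ^ 2 * (‖z‖ ^ 2 / (2 * ‖x‖)) =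
        (‖x‖ ^ 2 + ‖x + s • z‖ ^ 2) / (2 * ‖x‖) := by
      rw [h1, normDeriv, if_neg hx]
      field_simp
      ring
    rw [h3, le_div_iff₀ (by positivity)]
    linarith

theorem normDeriv_add_smul_neg_self (x r : E) (ε : ℝ) :
    normDeriv x (r + ε • -x) = normDeriv x r - ε * ‖x‖ := by
  unfold normDeriv
  split_ifs with hx
  · simp [hx]
  · have hx' : ‖x‖ ≠ 0 := norm_ne_zero_iff.2 hx
    rw [inner_add_right, inner_smul_right, inner_neg_right, real_inner_self_eq_norm_sq]
    field_simp
    ring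

theorem inner_sub_normResidual_le (x g : E) {c : ℝ} (hc : 0 ≤ c) (z : E) :
    inner ℝ (g - normResidual x g c) z ≤ c * normDeriv x z := by
  unfold normDeriv normResidual
  split_ifs with hx
  · rcases eq_or_ne g 0 with hg | hg
    · simp only [hg, smul_zero, sub_zero, inner_zero_left]
      positivity
    · have hg' : 0 < ‖g‖ := norm_pos_iff.2 hg
      have h1 : g - max 0 (1 - c / ‖g‖) • g = (1 - max 0 (1 - c / ‖g‖)) • g := by
        rw [sub_smul, one_smul]
      refine (real_inner_le_norm _ _).trans (mul_le_mul_of_nonneg_right ?_ (norm_nonneg z))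
      have h2 : 0 ≤ 1 - max 0 (1 - c / ‖g‖) := by
        have : 0 ≤ c / ‖g‖ := by positivity
        rw [sub_nonneg]
        exact max_le zero_le_one (by linarith)
      rw [h1, norm_smul, Real.norm_of_nonneg h2]
      calc (1 - max 0 (1 - c / ‖g‖)) * ‖g‖ ≤ (c / ‖g‖) * ‖g‖ := by
            gcongr
            linarith [le_max_right 0 (1 - c / ‖g‖)]
        _ = c := by field_simp
  · rw [sub_sub_cancel, inner_smul_left]
    apply le_of_eq
    simp only [conj_trivial]
    ring

theorem norm_normResidual_zero (g : E) {c : ℝ} (hc : 0 ≤ c) :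
    ‖normResidual 0 g c‖ = max (‖g‖ - c) 0 := by
  rw [normResidual, if_pos rfl, norm_smul, Real.norm_of_nonneg (le_max_left _ _)]
  rcases eq_or_ne g 0 with hg | hg
  · simp [hg, hc]
  · have hg' : 0 < ‖g‖ := norm_pos_iff.2 hg
    rw [max_mul_of_nonneg _ _ hg'.le, zero_mul, max_comm]
    congr 1
    field_simp

open Classical in
theorem normDeriv_normResidual (x g : E) {c : ℝ} (hc : 0 ≤ c) :
    normDeriv x (normResidual x g c) =
      if x = 0 then max (normDeriv x g - c) 0 else normDeriv x g - c := by
  split_ifs with hx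
  · subst hx
    simp only [normDeriv, if_pos]
    exact norm_normResidual_zero g hc
  · have hx' : ‖x‖ ≠ 0 := norm_ne_zero_iff.2 hx
    simp only [normDeriv, if_neg hx, normResidual]
    rw [inner_sub_right, inner_smul_right, real_inner_self_eq_norm_sq]
    field_simp

open Classical in
theorem norm_normResidual_sq (x g : E) {c : ℝ} (hc : 0 ≤ c) :
    ‖normResidual x g c‖ ^ 2 =
      if x = 0 then max (normDeriv x g - c) 0 ^ 2
      else ‖g‖ ^ 2 - 2 * c * normDeriv x g + c ^ 2 := by
  split_ifs with hx
  · subst hx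
    rw [norm_normResidual_zero g hc]
    simp [normDeriv]
  · have hx' : ‖x‖ ≠ 0 := norm_ne_zero_iff.2 hx
    simp only [normDeriv, if_neg hx, normResidual]
    rw [norm_sub_sq_real, inner_smul_right, norm_smul, mul_pow, Real.norm_eq_abs, sq_abs,
      real_inner_comm]
    field_simp

/-- The residual is a normal direction at the projection, which is why the subgradient inequality
holds with equality there. -/
theorem inner_sub_normResidual_self (x g : E) {c : ℝ} (hc : 0 ≤ c) :
    inner ℝ (g - normResidual x g c) (normResidual x g c) =
      c * normDeriv x (normResidual x g c) := by
  by_cases hx : x = 0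
  · subst hx
    rw [inner_sub_left, real_inner_self_eq_norm_sq]
    simp only [normDeriv, if_true]
    rw [norm_normResidual_zero g hc, normResidual, if_pos rfl, inner_smul_right,
      real_inner_self_eq_norm_sq]
    rcases eq_or_ne g 0 with hg | hg
    · simp [hg, hc]
    · have hg' : 0 < ‖g‖ := norm_pos_iff.2 hg
      have h1 : max 0 (1 - c / ‖g‖) * ‖g‖ ^ 2 = max (‖g‖ - c) 0 * ‖g‖ := by
        rw [sq, ← mul_assoc, max_mul_of_nonneg _ _ hg'.le, zero_mul, max_comm]
        congr 2
        field_simp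
      rw [h1]
      rcases le_total ‖g‖ c with h | h
      · rw [max_eq_right (by linarith)]
        ring
      · rw [max_eq_left (by linarith)]
        ring
  · simp only [normDeriv, if_neg hx, normResidual]
    rw [sub_sub_cancel, inner_smul_left]
    simp only [conj_trivial]
    ring

theorem continuous_normDeriv (x : E) : Continuous (normDeriv x) := by
  unfold normDeriv
  split_ifs
  · exact continuous_norm
  · fun_prop

theorem abs_normDeriv_le (x z : E) : |normDeriv x z| ≤ ‖z‖ := by
  unfold normDeriv
  split_ifs with hx
  · simp
  · have hx' : 0 < ‖x‖ := norm_pos_iff.2 hx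
    rw [abs_div, abs_of_pos hx', div_le_iff₀ hx', mul_comm]
    exact abs_real_inner_le_norm x z

end NormDeriv

/-! ### Descent cone of the weighted norm and its polar -/

section Geometry

variable {n q : ℕ} {V : Fin q → Finset (Fin n)}

/-- The subvector indexed by the block `V b`. -/
noncomputable def block (V : Fin q → Finset (Fin n)) (b : Fin q) :
    EuclideanSpace ℝ (Fin n) →ₗ[ℝ] EuclideanSpace ℝ (V b) where
  toFun z := WithLp.toLp 2 fun j => z j
  map_add' _ _ := rfl
  map_smul' _ _ := rfl

theorem block_apply (b : Fin q) (z : EuclideanSpace ℝ (Fin n)) (j : V b) :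
    block V b z j = z j := rfl

theorem norm_block (b : Fin q) (z : EuclideanSpace ℝ (Fin n)) :
    ‖block V b z‖ = blockNorm (V b) z := by
  rw [EuclideanSpace.norm_eq, blockNorm]
  congr 1
  simp only [block_apply, Real.norm_eq_abs, sq_abs]
  exact Finset.sum_coe_sort (V b) fun j => z j ^ 2

theorem IsPartitionOf.sum_eq {ι α : Type*} [Fintype ι] [Fintype α] {P : ι → Finset α}
    (hP : IsPartitionOf P) (f : α → ℝ) : ∑ j, f j = ∑ b, ∑ j ∈ P b, f j := by
  classical
  rw [← Finset.sum_biUnion fun b _ c _ hbc => hP.2.1 b c hbc]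
  congr 1
  ext j
  simpa using hP.2.2 j

theorem inner_eq_sum_block (hV : IsPartitionOf V) (y z : EuclideanSpace ℝ (Fin n)) :
    inner ℝ y z = ∑ b, inner ℝ (block V b y) (block V b z) := by
  simp only [PiLp.inner_apply, block_apply]
  rw [hV.sum_eq]
  exact Finset.sum_congr rfl fun b _ =>
    (Finset.sum_coe_sort (V b) fun j => inner ℝ (y j) (z j)).symm

theorem norm_sq_eq_sum_block (hV : IsPartitionOf V) (z : EuclideanSpace ℝ (Fin n)) :
    ‖z‖ ^ 2 = ∑ b, ‖block V b z‖ ^ 2 := by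
  simp only [← real_inner_self_eq_norm_sq]
  exact inner_eq_sum_block hV z z

theorem exists_block_eq (hV : IsPartitionOf V) (v : ∀ b, EuclideanSpace ℝ (V b)) :
    ∃ z, ∀ b, block V b z = v b := by
  choose c hc using hV.2.2
  refine ⟨WithLp.toLp 2 fun j => v (c j) ⟨j, hc j⟩, fun b => ?_⟩
  ext ⟨j, hj⟩
  rw [block_apply]
  have hcb : c j = b := by
    by_contra hne
    exact Finset.disjoint_left.1 (hV.2.1 _ _ hne) (hc j) hj
  subst hcb
  rfl

theorem weightedL12_eq (w : Fin q → ℝ) (z : EuclideanSpace ℝ (Fin n)) :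
    weightedL12 V w z = ∑ b, w b * ‖block V b z‖ := by
  simp only [weightedL12, norm_block]

theorem zero_mem_polarCone (C : Set (EuclideanSpace ℝ (Fin n))) : 0 ∈ polarCone C := by
  intro z _
  simp

theorem infDist_le_of_mem {C : Set (EuclideanSpace ℝ (Fin n))} {g y : EuclideanSpace ℝ (Fin n)}
    (hy : y ∈ C) {F : ℝ} (h : ‖g - y‖ ^ 2 ≤ F) : Metric.infDist g C ^ 2 ≤ F := by
  refine le_trans ?_ h
  have := Metric.infDist_le_dist_of_mem (x := g) hy
  rw [dist_eq_norm] at this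
  exact pow_le_pow_left₀ Metric.infDist_nonneg this 2

theorem le_infDist_sq {C : Set (EuclideanSpace ℝ (Fin n))} (hC : C.Nonempty)
    {g : EuclideanSpace ℝ (Fin n)} {F : ℝ} (h : ∀ y ∈ C, F ≤ ‖g - y‖ ^ 2) :
    F ≤ Metric.infDist g C ^ 2 := by
  rcases le_or_gt F 0 with hF | hF
  · exact hF.trans (sq_nonneg _)
  · have h1 : Real.sqrt F ≤ Metric.infDist g C := by
      rw [Metric.le_infDist hC]
      intro y hy
      rw [dist_eq_norm]
      exact Real.sqrt_le_iff.2 ⟨norm_nonneg _, h y hy⟩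
    calc F = Real.sqrt F ^ 2 := (Real.sq_sqrt hF.le).symm
      _ ≤ _ := pow_le_pow_left₀ (Real.sqrt_nonneg _) h1 2

/-- Squared distance from `g` to `t` times the subdifferential at `x` of the weighted norm. -/
noncomputable def subdiffDistSq (V : Fin q → Finset (Fin n)) (w : Fin q → ℝ)
    (x g : EuclideanSpace ℝ (Fin n)) (t : ℝ) : ℝ :=
  ∑ b, ‖normResidual (block V b x) (block V b g) (t * w b)‖ ^ 2

/-- Scaled subgradients lie in the polar of the descent cone. -/
theorem infDist_polarCone_sq_le (hV : IsPartitionOf V) {w : Fin q → ℝ} (hw : ∀ b, 0 ≤ w b)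
    (x g : EuclideanSpace ℝ (Fin n)) {t : ℝ} (ht : 0 ≤ t) :
    Metric.infDist g (polarCone (descentCone (weightedL12 V w) x)) ^ 2 ≤
      subdiffDistSq V w x g t := by
  obtain ⟨r, hr⟩ := exists_block_eq hV fun b =>
    normResidual (block V b x) (block V b g) (t * w b)
  refine infDist_le_of_mem (y := g - r) ?_ ?_
  · rintro z ⟨s, hs, hz⟩
    have h1 : s * inner ℝ (g - r) z ≤ t * (weightedL12 V w (x + s • z) - weightedL12 V w x) := by
      rw [← inner_smul_right, inner_eq_sum_block hV, weightedL12_eq, weightedL12_eq,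
        ← Finset.sum_sub_distrib, Finset.mul_sum]
      refine Finset.sum_le_sum fun b _ => ?_
      rw [map_sub, hr, map_add]
      have htw : 0 ≤ t * w b := mul_nonneg ht (hw b)
      have h2 := inner_sub_normResidual_le (block V b x) (block V b g) htw (block V b (s • z))
      have h3 := mul_le_mul_of_nonneg_left
        (normDeriv_le_norm_add_sub (block V b x) (block V b (s • z))) htw
      nlinarith
    have h2 : s * inner ℝ (g - r) z ≤ 0 :=
      h1.trans (mul_nonpos_of_nonneg_of_nonpos ht (sub_nonpos.2 hz))
    by_contra hcon
    push Not at hcon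
    nlinarith [mul_pos hs hcon]
  · rw [sub_sub_cancel, norm_sq_eq_sum_block hV, subdiffDistSq]
    simp only [hr, le_refl]

/-- If the directional derivative is negative, a small step decreases the norm. -/
theorem mem_descentCone_of_neg {w : Fin q → ℝ} (hw : ∀ b, 0 ≤ w b)
    {x z : EuclideanSpace ℝ (Fin n)}
    (hz : ∑ b, w b * normDeriv (block V b x) (block V b z) < 0) :
    z ∈ descentCone (weightedL12 V w) x := by
  choose K hK hKs using fun b => norm_add_smul_le (block V b x) (block V b z)
  set D := ∑ b, w b * normDeriv (block V b x) (block V b z)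
  set S := ∑ b, w b * K b
  have hS : 0 ≤ S := Finset.sum_nonneg fun b _ => mul_nonneg (hw b) (hK b)
  have hs : 0 < -D / (S + 1) := div_pos (neg_pos.2 hz) (by linarith)
  refine ⟨-D / (S + 1), hs, ?_⟩
  set s := -D / (S + 1) with hsdef
  have h1 : weightedL12 V w (x + s • z) ≤ weightedL12 V w x + s * D + s ^ 2 * S := by
    rw [weightedL12_eq, weightedL12_eq, Finset.mul_sum, Finset.mul_sum,
      ← Finset.sum_add_distrib, ← Finset.sum_add_distrib]
    refine Finset.sum_le_sum fun b _ => ?_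
    rw [map_add, map_smul]
    have := mul_le_mul_of_nonneg_left (hKs b s hs.le) (hw b)
    linarith
  have h2 : s * (S + 1) = -D := by
    rw [hsdef]
    field_simp
  have h3 : s * D + s ^ 2 * S = -s ^ 2 := by
    have : D = -(s * (S + 1)) := by linarith
    rw [this]
    ring
  nlinarith [sq_nonneg s]

/-- If the residual at `t` is a critical direction, the projection of `g` onto the polar cone is
attained on `t` times the subdifferential. -/
theorem le_infDist_polarCone_sq (hV : IsPartitionOf V) {w : Fin q → ℝ} (hw : ∀ b, 0 ≤ w b)
    {x g : EuclideanSpace ℝ (Fin n)} (hx : 0 < weightedL12 V w x) {t : ℝ} (ht : 0 ≤ t)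
    (hD : ∑ b, w b * normDeriv (block V b x)
      (normResidual (block V b x) (block V b g) (t * w b)) ≤ 0)
    (htD : t * ∑ b, w b * normDeriv (block V b x)
      (normResidual (block V b x) (block V b g) (t * w b)) = 0) :
    subdiffDistSq V w x g t ≤
      Metric.infDist g (polarCone (descentCone (weightedL12 V w) x)) ^ 2 := by
  obtain ⟨r, hr⟩ := exists_block_eq hV fun b =>
    normResidual (block V b x) (block V b g) (t * w b)
  have hF : subdiffDistSq V w x g t = ‖r‖ ^ 2 := by
    rw [norm_sq_eq_sum_block hV, subdiffDistSq]
    simp only [hr]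
  have hgr : inner ℝ (g - r) r = 0 := by
    rw [inner_eq_sum_block hV, ← htD, Finset.mul_sum]
    refine Finset.sum_congr rfl fun b _ => ?_
    rw [map_sub, hr, inner_sub_normResidual_self _ _ (mul_nonneg ht (hw b))]
    ring
  rw [hF]
  refine le_infDist_sq ⟨0, zero_mem_polarCone _⟩ fun y hy => ?_
  -- perturbing `r` towards `-x` makes the directional derivative negative
  have hyr : ∀ ε : ℝ, 0 < ε → inner ℝ y r - ε * inner ℝ y x ≤ 0 := by
    intro ε hε
    have hmem : r + ε • -x ∈ descentCone (weightedL12 V w) x := by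
      refine mem_descentCone_of_neg hw ?_
      have e : ∑ b, w b * normDeriv (block V b x) (block V b (r + ε • -x)) =
          (∑ b, w b * normDeriv (block V b x)
            (normResidual (block V b x) (block V b g) (t * w b))) - ε * weightedL12 V w x := by
        rw [weightedL12_eq, Finset.mul_sum, ← Finset.sum_sub_distrib]
        refine Finset.sum_congr rfl fun b _ => ?_
        rw [map_add, map_smul, map_neg, hr, normDeriv_add_smul_neg_self]
        ring
      rw [e]
      nlinarith [mul_pos hε hx]
    have := hy _ hmem
    rw [inner_add_right, inner_smul_right, inner_neg_right] at this
    linarith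
  have hyr0 : inner ℝ y r ≤ 0 := by
    refine le_of_forall_pos_le_add fun δ hδ => ?_
    have hpos : 0 < |inner ℝ y x| + 1 := by positivity
    have h1 := hyr (δ / (|inner ℝ y x| + 1)) (by positivity)
    have h2 : δ / (|inner ℝ y x| + 1) * inner ℝ y x ≤ δ := by
      rw [div_mul_eq_mul_div, div_le_iff₀ hpos]
      have := le_abs_self (inner ℝ y x)
      nlinarith
    linarith
  have hsplit : ‖g - y‖ ^ 2 = ‖r‖ ^ 2 + 2 * inner ℝ r (g - y - r) + ‖g - y - r‖ ^ 2 := by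
    rw [← norm_add_sq_real, add_sub_cancel]
  have hin : inner ℝ r (g - y - r) = inner ℝ (g - r) r - inner ℝ y r := by
    rw [show g - y - r = (g - r) - y by abel, inner_sub_right, real_inner_comm, real_inner_comm y r]
  rw [hsplit, hin, hgr]
  nlinarith [sq_nonneg ‖g - y - r‖]

/-- The descent cone contains every block of weight zero. -/
theorem sum_le_infDist_polarCone_sq (hV : IsPartitionOf V) (w : Fin q → ℝ)
    (x g : EuclideanSpace ℝ (Fin n)) :
    ∑ b, (if w b = 0 then ‖block V b g‖ ^ 2 else 0) ≤
      Metric.infDist g (polarCone (descentCone (weightedL12 V w) x)) ^ 2 := by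
  refine le_infDist_sq ⟨0, zero_mem_polarCone _⟩ fun y hy => ?_
  rw [norm_sq_eq_sum_block hV]
  refine Finset.sum_le_sum fun b _ => ?_
  split_ifs with hb
  · classical
    obtain ⟨z, hz⟩ := exists_block_eq hV fun c => if c = b then block V c y else 0
    have hmem : z ∈ descentCone (weightedL12 V w) x := by
      refine ⟨1, one_pos, le_of_eq ?_⟩
      rw [weightedL12_eq, weightedL12_eq]
      refine Finset.sum_congr rfl fun c _ => ?_
      by_cases hc : c = b
      · subst hc
        simp [hb]
      · simp [hz, hc]
    have h1 := hy z hmem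
    rw [inner_eq_sum_block hV, Finset.sum_eq_single b] at h1
    · rw [hz, if_pos rfl, real_inner_self_eq_norm_sq] at h1
      have h2 : block V b y = 0 := by
        rw [← norm_eq_zero]
        exact pow_eq_zero_iff two_ne_zero |>.1 (le_antisymm h1 (sq_nonneg _))
      rw [map_sub, h2, sub_zero]
    · intro c _ hc
      rw [hz, if_neg hc, inner_zero_right]
    · simp
  · positivity

end Geometry

/-! ### Laws of the block statistics of a Gaussian vector -/

section Laws

open ProbabilityTheory

variable {E : Type*} [NormedAddCommGroup E] [InnerProductSpace ℝ E] [FiniteDimensional ℝ E]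
  [MeasurableSpace E] [BorelSpace E]

theorem integrable_exp_neg_norm_sq_div_two :
    Integrable (fun v : E => Real.exp (-‖v‖ ^ 2 / 2)) := by
  have h := (GaussianFourier.integrable_cexp_neg_mul_sq_norm_add (V := E) (b := 1 / 2)
    (by norm_num) 0 0).norm
  refine h.congr (Filter.Eventually.of_forall fun v => ?_)
  simp only [Complex.norm_exp]
  congr 1
  have : (-(1 / 2 : ℂ) * (‖v‖ : ℂ) ^ 2 + 0 * ((inner ℝ (0 : E) v : ℝ) : ℂ)) =
      ((-‖v‖ ^ 2 / 2 : ℝ) : ℂ) := by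
    push_cast
    ring
  rw [this, Complex.ofReal_re]

/-- The standard Gaussian measure has density proportional to `exp (-‖v‖² / 2)`. -/
theorem exists_stdGaussian_eq_withDensity : ∃ C : ℝ, 0 < C ∧
    stdGaussian E = (volume : Measure E).withDensity
      fun v => ENNReal.ofReal (C * Real.exp (-‖v‖ ^ 2 / 2)) := by
  have hint := integrable_exp_neg_norm_sq_div_two (E := E)
  set J := ∫ v : E, Real.exp (-‖v‖ ^ 2 / 2) with hJ
  have hJpos : 0 < J := by
    rw [hJ]
    have h : ∀ v : E, Real.exp (-‖v‖ ^ 2 / 2) = Real.exp (-(1 / 2) * ‖v‖ ^ 2) := fun v => by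
      congr 1
      ring
    simp only [h]
    rw [GaussianFourier.integral_rexp_neg_mul_sq_norm (by norm_num)]
    positivity
  refine ⟨J⁻¹, inv_pos.2 hJpos, ?_⟩
  have hmeas : Measurable fun v : E => ENNReal.ofReal (J⁻¹ * Real.exp (-‖v‖ ^ 2 / 2)) := by
    fun_prop
  have hfin : IsFiniteMeasure ((volume : Measure E).withDensity
      fun v => ENNReal.ofReal (J⁻¹ * Real.exp (-‖v‖ ^ 2 / 2))) :=
    isFiniteMeasure_withDensity_ofReal (hint.const_mul J⁻¹).2
  refine Measure.ext_of_charFun (funext fun t => ?_)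
  rw [charFun_stdGaussian, charFun_apply,
    integral_withDensity_eq_integral_toReal_smul hmeas (by simp)]
  have h1 : ∀ v : E, (ENNReal.ofReal (J⁻¹ * Real.exp (-‖v‖ ^ 2 / 2))).toReal •
      Complex.exp ((inner ℝ v t : ℝ) * Complex.I) =
      (J⁻¹ : ℂ) * Complex.exp (-(1 / 2 : ℂ) * (‖v‖ : ℂ) ^ 2 + Complex.I * (inner ℝ t v : ℝ)) := by
    intro v
    rw [ENNReal.toReal_ofReal (by positivity), Complex.real_smul, Complex.exp_add]
    push_cast
    rw [mul_assoc, real_inner_comm, mul_comm Complex.I]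
    congr 3
    ring
  have h2 : (J : ℂ) = ∫ v : E, Complex.exp (-(1 / 2 : ℂ) * (‖v‖ : ℂ) ^ 2) := by
    rw [hJ, ← integral_complex_ofReal]
    congr 1
    funext v
    push_cast
    congr 1
    ring
  simp only [h1]
  rw [integral_const_mul, GaussianFourier.integral_cexp_neg_mul_sq_norm_add (by norm_num),
    ← GaussianFourier.integral_cexp_neg_mul_sq_norm (by norm_num), ← h2, ← mul_assoc,
    inv_mul_cancel₀ (by exact_mod_cast hJpos.ne'), one_mul, Complex.I_sq]
  congr 1
  ring

theorem hasChiDensity_map_norm [Nontrivial E] :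
    HasChiDensity (Module.finrank ℝ E) ((stdGaussian E).map fun v => ‖v‖) := by
  obtain ⟨C, hC, hγ⟩ := exists_stdGaussian_eq_withDensity (E := E)
  refine ⟨C * (Module.finrank ℝ E * (volume : Measure E).real (Metric.ball 0 1)), by positivity,
    fun h hh => ?_⟩
  have hmeas : Measurable fun v : E => ENNReal.ofReal (C * Real.exp (-‖v‖ ^ 2 / 2)) := by
    fun_prop
  rw [integral_map (by fun_prop) hh.aestronglyMeasurable, hγ,
    integral_withDensity_eq_integral_toReal_smul hmeas (by simp)]
  have h1 : ∀ v : E, (ENNReal.ofReal (C * Real.exp (-‖v‖ ^ 2 / 2))).toReal • h ‖v‖ =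
      C * (fun y : ℝ => Real.exp (-y ^ 2 / 2) * h y) ‖v‖ := by
    intro v
    rw [ENNReal.toReal_ofReal (by positivity), smul_eq_mul, mul_assoc]
  simp only [h1]
  rw [integral_const_mul,
    integral_fun_norm_addHaar volume (fun y : ℝ => Real.exp (-y ^ 2 / 2) * h y)]
  simp only [nsmul_eq_mul, smul_eq_mul]
  rw [mul_assoc, mul_assoc]
  congr 4
  funext y
  ring

theorem map_inner_stdGaussian {u : E} (hu : ‖u‖ = 1) :
    (stdGaussian E).map (fun v => inner ℝ u v) = gaussianReal 0 1 := by
  have h := IsGaussian.map_eq_gaussianReal (μ := stdGaussian E) (innerSL ℝ u)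
  rw [integral_strongDual_stdGaussian, variance_dual_stdGaussian, innerSL_apply_norm, hu] at h
  simpa using h

theorem integral_norm_sq_stdGaussian :
    ∫ v, ‖v‖ ^ 2 ∂(stdGaussian E) = Module.finrank ℝ E := by
  have h1 : ∀ i, ∫ v, (inner ℝ (stdOrthonormalBasis ℝ E i) v) ^ 2 ∂(stdGaussian E) = 1 := by
    intro i
    have h := integral_map (μ := stdGaussian E)
      (φ := fun v => inner ℝ (stdOrthonormalBasis ℝ E i) v) (by fun_prop) (f := fun y : ℝ => y ^ 2)
      (by fun_prop)
    rw [map_inner_stdGaussian (by simp)] at h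
    rw [← h]
    have hv := variance_eq_sub (μ := gaussianReal 0 1) (X := fun x : ℝ => x)
      IsGaussian.memLp_two_id
    rw [variance_fun_id_gaussianReal] at hv
    simpa using hv.symm
  have h2 : ∀ i, Integrable (fun v => (inner ℝ (stdOrthonormalBasis ℝ E i) v) ^ 2)
      (stdGaussian E) := by
    intro i
    have h := (IsGaussian.memLp_two_id (μ := stdGaussian E)).const_inner
      (𝕜 := ℝ) (stdOrthonormalBasis ℝ E i)
    exact h.integrable_sq
  simp only [← (stdOrthonormalBasis ℝ E).sum_sq_inner_right]
  rw [integral_finsetSum _ fun i _ => h2 i]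
  simp [h1]

theorem memLp_normDeriv (x : E) : MemLp (normDeriv x) 2 (stdGaussian E) :=
  (IsGaussian.memLp_two_id (μ := stdGaussian E)).norm.mono'
    (continuous_normDeriv x).aestronglyMeasurable
    (Filter.Eventually.of_forall fun z => abs_normDeriv_le x z)

theorem map_normDeriv_of_ne_zero {x : E} (hx : x ≠ 0) :
    (stdGaussian E).map (normDeriv x) = gaussianReal 0 1 := by
  have hx' : ‖x‖ ≠ 0 := norm_ne_zero_iff.2 hx
  rw [← map_inner_stdGaussian (E := E) (u := ‖x‖⁻¹ • x)]
  · congr 1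
    funext z
    rw [normDeriv, if_neg hx, real_inner_smul_left]
    ring
  · rw [norm_smul, norm_inv, norm_norm, inv_mul_cancel₀ hx']

theorem hasChiDensity_map_normDeriv_zero [Nontrivial E] :
    HasChiDensity (Module.finrank ℝ E) ((stdGaussian E).map (normDeriv 0)) := by
  have h : normDeriv (0 : E) = fun v => ‖v‖ := by
    funext v
    simp [normDeriv]
  rw [h]
  exact hasChiDensity_map_norm

/-- The normalization of a density proportional to `x ^ (k - 1) * exp (-x² / 2)`. -/
theorem HasChiDensity.integral_eq {k : ℕ} (hk : 1 ≤ k) {μ : Measure ℝ} [IsProbabilityMeasure μ]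
    (hμ : HasChiDensity k μ) {h : ℝ → ℝ} (hh : Measurable h) :
    ∫ x, h x ∂μ = ((2 : ℝ) ^ ((k : ℝ) / 2 - 1) * Real.Gamma ((k : ℝ) / 2))⁻¹ *
      ∫ x in Set.Ioi (0 : ℝ), h x * (x ^ (k - 1) * Real.exp (-x ^ 2 / 2)) := by
  obtain ⟨C, -, hμ⟩ := hμ
  have hk' : (0 : ℝ) < k := by exact_mod_cast hk
  have h1 : ∫ x in Set.Ioi (0 : ℝ), x ^ (k - 1) * Real.exp (-x ^ 2 / 2) =
      (2 : ℝ) ^ ((k : ℝ) / 2 - 1) * Real.Gamma ((k : ℝ) / 2) := by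
    have h2 := integral_rpow_mul_exp_neg_mul_rpow (p := 2) (q := (k : ℝ) - 1) (b := 1 / 2)
      (by norm_num) (by linarith) (by norm_num)
    rw [sub_add_cancel] at h2
    have h3 : ∫ x in Set.Ioi (0 : ℝ), x ^ (k - 1) * Real.exp (-x ^ 2 / 2) =
        ∫ x in Set.Ioi (0 : ℝ), x ^ ((k : ℝ) - 1) * Real.exp (-(1 / 2) * x ^ (2 : ℝ)) := by
      refine setIntegral_congr_fun measurableSet_Ioi fun x _ => ?_
      have : (k : ℝ) - 1 = ((k - 1 : ℕ) : ℝ) := by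
        rw [Nat.cast_sub hk, Nat.cast_one]
      simp only [this, Real.rpow_natCast, Real.rpow_ofNat]
      ring_nf
    rw [h3, h2, neg_div, Real.rpow_neg (by norm_num), one_div, Real.inv_rpow (by norm_num), inv_inv,
      Real.rpow_sub (by norm_num), Real.rpow_one]
    ring
  have h4 := hμ (fun _ => 1) measurable_const
  simp only [one_mul, h1, integral_const, probReal_univ, smul_eq_mul, mul_one] at h4
  rw [hμ h hh]
  congr 1
  exact eq_inv_of_mul_eq_one_left h4.symm

theorem HasChiDensity.integral_posPart_sq {k : ℕ} (hk : 1 ≤ k) {μ : Measure ℝ}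
    [IsProbabilityMeasure μ] (hμ : HasChiDensity k μ) {c : ℝ} (hc : 0 ≤ c) :
    ∫ x, max (x - c) 0 ^ 2 ∂μ =
      phiB k c / ((2 : ℝ) ^ ((k : ℝ) / 2 - 1) * Real.Gamma ((k : ℝ) / 2)) := by
  rw [hμ.integral_eq hk (by fun_prop), mul_comm, ← div_eq_mul_inv]
  congr 1
  rw [phiB, ← integral_indicator measurableSet_Ioi, ← integral_indicator measurableSet_Ioi]
  congr 1
  funext x
  simp only [Set.indicator, Set.mem_Ioi]
  rcases lt_or_ge c x with h | h
  · rw [if_pos h, if_pos (hc.trans_lt h), max_eq_left (by linarith)]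
    ring
  · rw [if_neg (not_lt.2 h), max_eq_right (by linarith)]
    simp

end Laws

section Blocks

open ProbabilityTheory

variable {n q : ℕ} {V : Fin q → Finset (Fin n)}

theorem continuous_block (b : Fin q) : Continuous (block V b) :=
  (block V b).continuous_of_finiteDimensional

/-- The blocks of a standard Gaussian vector are independent standard Gaussian vectors. -/
theorem map_block_stdGaussian (hV : IsPartitionOf V) :
    (stdGaussian (EuclideanSpace ℝ (Fin n))).map (fun g b => block V b g) =
      Measure.pi fun b => stdGaussian (EuclideanSpace ℝ (V b)) := by
  have hm : Measurable fun (g : EuclideanSpace ℝ (Fin n)) b => block V b g :=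
    measurable_pi_lambda _ fun b => (continuous_block b).measurable
  have : IsProbabilityMeasure ((stdGaussian (EuclideanSpace ℝ (Fin n))).map
    (fun g b => block V b g)) := Measure.isProbabilityMeasure_map hm.aemeasurable
  refine charFun_eq_pi_iff.1 fun t => ?_
  obtain ⟨T, hT⟩ := exists_block_eq hV fun b => t b
  have hm' : Measurable fun z : (b : Fin q) → EuclideanSpace ℝ (V b) =>
      (WithLp.toLp 2 z : PiLp 2 fun b => EuclideanSpace ℝ (V b)) := by fun_prop
  rw [Measure.map_map hm' hm, charFun_apply, integral_map (hm'.comp hm).aemeasurable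
    (by fun_prop)]
  have h1 : ∀ g : EuclideanSpace ℝ (Fin n),
      inner ℝ (((WithLp.toLp 2 : _ → PiLp 2 fun b => EuclideanSpace ℝ (V b)) ∘
        fun (g : EuclideanSpace ℝ (Fin n)) b => block V b g) g) t = inner ℝ g T := by
    intro g
    rw [PiLp.inner_apply, inner_eq_sum_block hV]
    simp only [hT]
    rfl
  simp only [h1]
  rw [← charFun_apply, charFun_stdGaussian]
  simp only [charFun_stdGaussian, ← Complex.exp_sum]
  congr 1
  rw [← Finset.sum_div, Finset.sum_neg_distrib]
  congr 2
  rw [← Complex.ofReal_pow, norm_sq_eq_sum_block hV]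
  push_cast
  simp only [hT]

theorem measurePreserving_block (hV : IsPartitionOf V) (b : Fin q) :
    MeasurePreserving (block V b) (stdGaussian (EuclideanSpace ℝ (Fin n)))
      (stdGaussian (EuclideanSpace ℝ (V b))) := by
  have hm : Measurable fun (g : EuclideanSpace ℝ (Fin n)) b => block V b g :=
    measurable_pi_lambda _ fun b => (continuous_block b).measurable
  have h1 : MeasurePreserving (fun (g : EuclideanSpace ℝ (Fin n)) b => block V b g)
    (stdGaussian (EuclideanSpace ℝ (Fin n)))
    (Measure.pi fun b => stdGaussian (EuclideanSpace ℝ (V b))) := ⟨hm, map_block_stdGaussian hV⟩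
  exact (measurePreserving_eval _ b).comp h1

/-- The law of the directional derivative of the norm of the block `b` at the signal `x`, in the
direction of a Gaussian vector. -/
noncomputable def blockLaw (V : Fin q → Finset (Fin n)) (x : EuclideanSpace ℝ (Fin n))
    (b : Fin q) : Measure ℝ :=
  (stdGaussian (EuclideanSpace ℝ (V b))).map (normDeriv (block V b x))

instance isProbabilityMeasure_blockLaw (x : EuclideanSpace ℝ (Fin n)) (b : Fin q) :
    IsProbabilityMeasure (blockLaw V x b) :=
  Measure.isProbabilityMeasure_map (continuous_normDeriv _).measurable.aemeasurable

/-- The vector of the directional derivatives of the block norms at `x` in direction `g`. -/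
noncomputable def blockDeriv (V : Fin q → Finset (Fin n)) (x g : EuclideanSpace ℝ (Fin n)) :
    Fin q → ℝ := fun b => normDeriv (block V b x) (block V b g)

theorem measurePreserving_blockDeriv (hV : IsPartitionOf V) (x : EuclideanSpace ℝ (Fin n)) :
    MeasurePreserving (blockDeriv V x) (stdGaussian (EuclideanSpace ℝ (Fin n)))
      (Measure.pi (blockLaw V x)) := by
  have hm : Measurable fun (g : EuclideanSpace ℝ (Fin n)) b => block V b g :=
    measurable_pi_lambda _ fun b => (continuous_block b).measurable
  have h1 : MeasurePreserving (fun (g : EuclideanSpace ℝ (Fin n)) b => block V b g)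
    (stdGaussian (EuclideanSpace ℝ (Fin n)))
    (Measure.pi fun b => stdGaussian (EuclideanSpace ℝ (V b))) := ⟨hm, map_block_stdGaussian hV⟩
  exact (measurePreserving_pi _ _ fun b => ⟨(continuous_normDeriv (block V b x)).measurable,
    rfl⟩).comp h1

theorem memLp_blockLaw (x : EuclideanSpace ℝ (Fin n)) (b : Fin q) :
    MemLp (fun y : ℝ => y) 2 (blockLaw V x b) :=
  (memLp_map_measure_iff (by fun_prop) (continuous_normDeriv _).aemeasurable).2 (memLp_normDeriv _)

theorem blockLaw_of_ne_zero {x : EuclideanSpace ℝ (Fin n)} {b : Fin q} (hx : block V b x ≠ 0) :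
    blockLaw V x b = gaussianReal 0 1 := map_normDeriv_of_ne_zero hx

theorem hasChiDensity_blockLaw {k : ℕ} {b : Fin q} (hk : (V b).card = k) (hk0 : 0 < k)
    {x : EuclideanSpace ℝ (Fin n)} (hx : block V b x = 0) :
    HasChiDensity k (blockLaw V x b) := by
  have hne : Nonempty (V b) := (Finset.card_pos.1 (hk ▸ hk0)).to_subtype
  have h := hasChiDensity_map_normDeriv_zero (E := EuclideanSpace ℝ (V b))
  rw [finrank_euclideanSpace, Fintype.card_coe, hk] at h
  rwa [blockLaw, hx]

theorem steinBound_blockLaw {b : Fin q} (hk : 0 < (V b).card) (x : EuclideanSpace ℝ (Fin n)) :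
    SteinBound (blockLaw V x b) := by
  by_cases hx : block V b x = 0
  · exact (hasChiDensity_blockLaw rfl hk hx).steinBound hk
  · rw [blockLaw_of_ne_zero hx]
    exact steinBound_gaussianReal

end Blocks

/-! ### The optimal dilation of the subdifferential -/

section Active

variable {ι : Type*} [DecidableEq ι]

/-- Coefficients of the linear forms whose maximum is the optimal dilation of the subdifferential:
the zero form, and for each set `S` of blocks the form `∑ w_b z_b / ∑ w_b²`, both sums over
`B ∪ S`. -/
noncomputable def activeCoeff (w : ι → ℝ) (B : Finset ι) : Option (Finset ι) → ι → ℝ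
  | none, _ => 0
  | some S, b => if b ∈ B ∪ S then w b / ∑ c ∈ B ∪ S, w c ^ 2 else 0

theorem activeCoeff_nonneg {w : ι → ℝ} (hw : ∀ b, 0 ≤ w b) (B : Finset ι) (i : Option (Finset ι))
    (b : ι) : 0 ≤ activeCoeff w B i b := by
  rcases i with _ | S
  · exact le_rfl
  · simp only [activeCoeff]
    split_ifs
    · exact div_nonneg (hw b) (Finset.sum_nonneg fun _ _ => sq_nonneg _)
    · exact le_rfl

theorem sum_activeCoeff_some [Fintype ι] (w : ι → ℝ) (B S : Finset ι) (z : ι → ℝ) :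
    ∑ b, activeCoeff w B (some S) b * z b =
      (∑ b ∈ B ∪ S, w b * z b) / ∑ b ∈ B ∪ S, w b ^ 2 := by
  simp only [activeCoeff, ite_mul, zero_mul, Finset.sum_ite_mem, Finset.univ_inter,
    Finset.sum_div]
  exact Finset.sum_congr rfl fun b _ => by ring

theorem sum_mul_activeCoeff_le [Fintype ι] (w : ι → ℝ) (B : Finset ι) (i : Option (Finset ι)) :
    ∑ b, w b * activeCoeff w B i b ≤ 1 := by
  rcases i with _ | S
  · simp [activeCoeff]
  · have h := sum_activeCoeff_some w B S w
    simp only [← pow_two] at h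
    calc ∑ b, w b * activeCoeff w B (some S) b = ∑ b, activeCoeff w B (some S) b * w b :=
          Finset.sum_congr rfl fun b _ => mul_comm _ _
      _ = (∑ b ∈ B ∪ S, w b ^ 2) / ∑ b ∈ B ∪ S, w b ^ 2 := h
      _ ≤ 1 := div_self_le_one _

theorem maxLinear_activeCoeff_nonneg [Fintype ι] (w : ι → ℝ) (B : Finset ι) (z : ι → ℝ) :
    0 ≤ maxLinear (activeCoeff w B) z := by
  have h := le_maxLinear (activeCoeff w B) z none
  simpa [activeCoeff] using h

/-- Half the negative slope, at dilation `t`, of the squared distance to the dilated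
subdifferential. -/
def dualSlope [Fintype ι] (w : ι → ℝ) (B : Finset ι) (z : ι → ℝ) (t : ℝ) : ℝ :=
  ∑ b, w b * if b ∈ B then z b - t * w b else max (z b - t * w b) 0

/-- The maximum of the linear forms satisfies the optimality conditions: the slope is nonpositive
since the forms include the one of the set of active blocks, and it vanishes at a positive maximum
since every form is dominated by the slope. -/
theorem dualSlope_maxLinear [Fintype ι] {w : ι → ℝ} (hw : ∀ b, 0 ≤ w b) {B : Finset ι}
    (hB : 0 < ∑ b ∈ B, w b ^ 2) (z : ι → ℝ) :
    dualSlope w B z (maxLinear (activeCoeff w B) z) ≤ 0 ∧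
      maxLinear (activeCoeff w B) z * dualSlope w B z (maxLinear (activeCoeff w B) z) = 0 := by
  set τ := maxLinear (activeCoeff w B) z with hτ
  have hτ0 : 0 ≤ τ := maxLinear_activeCoeff_nonneg w B z
  have hpos : ∀ S : Finset ι, 0 < ∑ b ∈ B ∪ S, w b ^ 2 := fun S =>
    hB.trans_le (Finset.sum_le_sum_of_subset_of_nonneg Finset.subset_union_left
      fun _ _ _ => sq_nonneg _)
  have hlin : ∀ S : Finset ι, ∑ b ∈ B ∪ S, w b * (z b - τ * w b) =
      ∑ b ∈ B ∪ S, w b * z b - τ * ∑ b ∈ B ∪ S, w b ^ 2 := by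
    intro S
    rw [Finset.mul_sum, ← Finset.sum_sub_distrib]
    exact Finset.sum_congr rfl fun b _ => by ring
  have hle : dualSlope w B z τ ≤ 0 := by
    -- the set of active blocks
    set S := Finset.univ.filter fun b => 0 < z b - τ * w b with hS
    have h1 : dualSlope w B z τ = ∑ b ∈ B ∪ S, w b * (z b - τ * w b) := by
      rw [dualSlope, ← Finset.univ_inter (B ∪ S), ← Finset.sum_ite_mem]
      refine Finset.sum_congr rfl fun b _ => ?_
      by_cases hbB : b ∈ B
      · simp [hbB]
      · by_cases hbS : 0 < z b - τ * w b
        · have hmem : b ∈ S := by simpa [hS] using hbS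
          simp [hbB, hmem, max_eq_left hbS.le]
        · have hmem : b ∉ S := by simpa [hS] using hbS
          simp [hbB, hmem, max_eq_right (not_lt.1 hbS)]
    have h2 := le_maxLinear (activeCoeff w B) z (some S)
    rw [sum_activeCoeff_some, div_le_iff₀ (hpos S), ← hτ] at h2
    rw [h1, hlin]
    linarith
  refine ⟨hle, ?_⟩
  rcases hτ0.eq_or_lt with h0 | h0
  · rw [← h0, zero_mul]
  · obtain ⟨i, hi⟩ := exists_eq_maxLinear (activeCoeff w B) z
    rw [← hτ] at hi
    rcases i with _ | S
    · simp [activeCoeff] at hi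
      linarith
    · rw [sum_activeCoeff_some, div_eq_iff (hpos S).ne'] at hi
      have h1 : ∑ b ∈ B ∪ S, w b * (z b - τ * w b) ≤ dualSlope w B z τ := by
        rw [dualSlope, ← Finset.univ_inter (B ∪ S), ← Finset.sum_ite_mem]
        refine Finset.sum_le_sum fun b _ => ?_
        by_cases hbB : b ∈ B
        · simp [hbB]
        · by_cases hbS : b ∈ S
          · simp only [Finset.mem_union, hbB, hbS, or_true, if_true, if_false]
            exact mul_le_mul_of_nonneg_left (le_max_left _ _) (hw b)
          · simp only [Finset.mem_union, hbB, hbS, or_self, if_false]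
            exact mul_nonneg (hw b) (le_max_right _ _)
      rw [hlin, hi, sub_self] at h1
      rw [le_antisymm hle h1, mul_zero]

end Active

/-! ### Mean squared distance to the dilated subdifferential -/

section Mean

open ProbabilityTheory

theorem integral_comp_measurePreserving {α β : Type*} [MeasurableSpace α] [MeasurableSpace β]
    {μ : Measure α} {ν : Measure β} {φ : α → β} (hφ : MeasurePreserving φ μ ν) {h : β → ℝ}
    (hh : Integrable h ν) : ∫ a, h (φ a) ∂μ = ∫ b, h b ∂ν := by
  rw [← hφ.map_eq, integral_map hφ.measurable.aemeasurable]
  rw [hφ.map_eq]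
  exact hh.aestronglyMeasurable

theorem memLp_posPart_sub {α : Type*} [MeasurableSpace α] {μ : Measure α} [IsFiniteMeasure μ]
    {f : α → ℝ} (hf : MemLp f 2 μ) (c : ℝ) : MemLp (fun a => max (f a - c) 0) 2 μ :=
  (hf.sub (memLp_const c)).pos_part

variable {n q : ℕ} {V : Fin q → Finset (Fin n)}

open Classical in
/-- The mean squared distance of one Gaussian block to the dilated subdifferential. -/
theorem integral_norm_normResidual_sq {k : ℕ} (hV : IsPartitionOf V) {b : Fin q}
    (hk : (V b).card = k) (hk0 : 0 < k) (x : EuclideanSpace ℝ (Fin n)) {c : ℝ} (hc : 0 ≤ c) :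
    Integrable (fun g => ‖normResidual (block V b x) (block V b g) c‖ ^ 2)
      (stdGaussian (EuclideanSpace ℝ (Fin n))) ∧
    ∫ g, ‖normResidual (block V b x) (block V b g) c‖ ^ 2
      ∂(stdGaussian (EuclideanSpace ℝ (Fin n))) =
      if block V b x = 0 then
        phiB k c / ((2 : ℝ) ^ ((k : ℝ) / 2 - 1) * Real.Gamma ((k : ℝ) / 2))
      else k + c ^ 2 := by
  set γ := stdGaussian (EuclideanSpace ℝ (V b)) with hγ
  have hmp := measurePreserving_block hV b
  have hN : Integrable (fun v => ‖v‖ ^ 2) γ :=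
    (IsGaussian.memLp_two_id (μ := γ)).norm.integrable_sq
  have hZ := memLp_normDeriv (block V b x)
  have key : Integrable (fun v => ‖normResidual (block V b x) v c‖ ^ 2) γ ∧
      ∫ v, ‖normResidual (block V b x) v c‖ ^ 2 ∂γ =
      if block V b x = 0 then
        phiB k c / ((2 : ℝ) ^ ((k : ℝ) / 2 - 1) * Real.Gamma ((k : ℝ) / 2))
      else k + c ^ 2 := by
    simp only [norm_normResidual_sq _ _ hc]
    split_ifs with hx
    · refine ⟨(memLp_posPart_sub hZ c).integrable_sq, ?_⟩
      rw [← (hasChiDensity_blockLaw hk hk0 hx).integral_posPart_sq hk0 hc, blockLaw,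
        integral_map (continuous_normDeriv _).aemeasurable (by fun_prop)]
    · have hZi := (hZ.integrable one_le_two).const_mul (2 * c)
      refine ⟨(hN.sub hZi).add (integrable_const _), ?_⟩
      have hZ0 : ∫ v, normDeriv (block V b x) v ∂γ = 0 := by
        have h := integral_map (μ := γ) (continuous_normDeriv (block V b x)).aemeasurable
          (f := fun y : ℝ => y) (by fun_prop)
        rw [hγ, map_normDeriv_of_ne_zero hx, ← hγ] at h
        rw [← h]
        simp
      have e1 : ∫ v, (‖v‖ ^ 2 - 2 * c * normDeriv (block V b x) v + c ^ 2) ∂γ =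
          ∫ v, (‖v‖ ^ 2 - 2 * c * normDeriv (block V b x) v) ∂γ + ∫ _, c ^ 2 ∂γ :=
        integral_add (hN.sub hZi) (integrable_const _)
      rw [e1, integral_sub hN hZi, integral_const_mul, hZ0, integral_norm_sq_stdGaussian,
        finrank_euclideanSpace, Fintype.card_coe, hk]
      simp
  exact ⟨hmp.integrable_comp_of_integrable key.1, by
    rw [← key.2]; exact integral_comp_measurePreserving hmp key.1⟩

theorem integrable_subdiffDistSq (hV : IsPartitionOf V) (hk : ∀ b, 0 < (V b).card)
    {w : Fin q → ℝ} (hw : ∀ b, 0 ≤ w b) (x : EuclideanSpace ℝ (Fin n)) {t : ℝ} (ht : 0 ≤ t) :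
    Integrable (fun g => subdiffDistSq V w x g t) (stdGaussian (EuclideanSpace ℝ (Fin n))) :=
  integrable_finsetSum _ fun b _ =>
    (integral_norm_normResidual_sq hV rfl (hk b) x (mul_nonneg ht (hw b))).1

theorem mem_blockSupport {x : EuclideanSpace ℝ (Fin n)} {b : Fin q} :
    b ∈ blockSupport V x ↔ block V b x ≠ 0 := by
  rw [blockSupport, Finset.mem_filter_univ, ← norm_block, norm_ne_zero_iff]

theorem blockWeights_of_mem {L : ℕ} {P : Fin L → Finset (Fin q)} (hP : IsPartitionOf P)
    (ω : Fin L → ℝ) {i : Fin L} {b : Fin q} (hb : b ∈ P i) : blockWeights P ω b = ω i := by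
  rw [blockWeights, Finset.sum_eq_single i]
  · simp [hb]
  · intro j _ hj
    rw [if_neg]
    intro hbj
    exact Finset.disjoint_left.1 (hP.2.1 j i hj) hbj hb
  · simp

theorem blockWeights_nonneg {L : ℕ} (P : Fin L → Finset (Fin q)) {ω : Fin L → ℝ}
    (hω : ∀ i, 0 ≤ ω i) (b : Fin q) : 0 ≤ blockWeights P ω b :=
  Finset.sum_nonneg fun i _ => by split_ifs <;> [exact hω i; exact le_rfl]

/-- The function minimized in the explicit bound is the normalized mean squared distance to the
dilated subdifferential. -/
theorem integral_subdiffDistSq {k L : ℕ} (hq : 0 < q) (hV : IsPartitionOf V)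
    (hk : ∀ b, (V b).card = k) (hk0 : 0 < k) {P : Fin L → Finset (Fin q)} (hP : IsPartitionOf P)
    {ω : Fin L → ℝ} (hω : ∀ i, 0 ≤ ω i) (x : EuclideanSpace ℝ (Fin n)) {t : ℝ} (ht : 0 ≤ t) :
    ∫ g, subdiffDistSq V (blockWeights P ω) x g t ∂(stdGaussian (EuclideanSpace ℝ (Fin n))) =
      q * Psi k ω (relativeSize P) (accuracy P (blockSupport V x)) t := by
  classical
  have hw := blockWeights_nonneg P hω
  have hb := fun b => integral_norm_normResidual_sq hV (hk b) hk0 x (mul_nonneg ht (hw b))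
  have hq' : (q : ℝ) ≠ 0 := by exact_mod_cast hq.ne'
  simp only [subdiffDistSq]
  rw [integral_finsetSum _ fun b _ => (hb b).1, hP.sum_eq, Psi, Finset.mul_sum]
  refine Finset.sum_congr rfl fun i _ => ?_
  set B := blockSupport V x with hB
  set κ := (2 : ℝ) ^ ((k : ℝ) / 2 - 1) * Real.Gamma ((k : ℝ) / 2)
  have h1 : ∀ b ∈ P i, ∫ g, ‖normResidual (block V b x) (block V b g) (t * blockWeights P ω b)‖ ^ 2
      ∂(stdGaussian (EuclideanSpace ℝ (Fin n))) =
      phiB k (t * ω i) / κ + if b ∈ B then (k + (t * ω i) ^ 2) - phiB k (t * ω i) / κ else 0 := by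
    intro b hbi
    rw [(hb b).2, blockWeights_of_mem hP ω hbi]
    by_cases hx : block V b x = 0
    · have : b ∉ B := fun h => mem_blockSupport.1 h hx
      simp [hx, this, κ]
    · have : b ∈ B := mem_blockSupport.2 hx
      simp [hx, this]
  have hPi : ((P i).card : ℝ) ≠ 0 := by exact_mod_cast (Finset.card_pos.2 (hP.1 i)).ne'
  rw [Finset.sum_congr rfl h1, Finset.sum_add_distrib, Finset.sum_const, Finset.sum_ite_mem,
    Finset.sum_const, relativeSize, accuracy, nsmul_eq_mul, nsmul_eq_mul]
  field_simp
  ring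

end Mean

/-! ### Comparison with the statistical dimension -/

section Comparison

open ProbabilityTheory

variable {n q : ℕ} {V : Fin q → Finset (Fin n)}

theorem integrable_infDist_polarCone_sq (C : Set (EuclideanSpace ℝ (Fin n))) :
    Integrable (fun g => Metric.infDist g (polarCone C) ^ 2)
      (stdGaussian (EuclideanSpace ℝ (Fin n))) := by
  have h := (IsGaussian.memLp_two_id (μ := stdGaussian (EuclideanSpace ℝ (Fin n)))).norm
  refine (h.mono' (Metric.continuous_infDist_pt _).aestronglyMeasurable
    (Filter.Eventually.of_forall fun g => ?_)).integrable_sq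
  rw [Real.norm_of_nonneg Metric.infDist_nonneg]
  simpa using Metric.infDist_le_dist_of_mem (x := g) (zero_mem_polarCone C)

theorem statDim_le (hV : IsPartitionOf V) (hk : ∀ b, 0 < (V b).card) {w : Fin q → ℝ}
    (hw : ∀ b, 0 ≤ w b) (x : EuclideanSpace ℝ (Fin n)) {t : ℝ} (ht : 0 ≤ t) :
    statDim (descentCone (weightedL12 V w) x) ≤
      ∫ g, subdiffDistSq V w x g t ∂(stdGaussian (EuclideanSpace ℝ (Fin n))) :=
  integral_mono (integrable_infDist_polarCone_sq _) (integrable_subdiffDistSq hV hk hw x ht)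
    fun g => infDist_polarCone_sq_le hV hw x g ht

/-- Tangent line inequality for the convex function `t ↦ subdiffDistSq V w x g t`. -/
theorem subdiffDistSq_sub_le {w : Fin q → ℝ} (hw : ∀ b, 0 ≤ w b)
    (x g : EuclideanSpace ℝ (Fin n)) {s t : ℝ} (hs : 0 ≤ s) (ht : 0 ≤ t) :
    subdiffDistSq V w x g s - subdiffDistSq V w x g t ≤
      2 * ((t - s) * dualSlope w (blockSupport V x) (blockDeriv V x g) s) := by
  rw [subdiffDistSq, subdiffDistSq, dualSlope, ← Finset.sum_sub_distrib, Finset.mul_sum,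
    Finset.mul_sum]
  refine Finset.sum_le_sum fun b _ => ?_
  rw [norm_normResidual_sq _ _ (mul_nonneg hs (hw b)),
    norm_normResidual_sq _ _ (mul_nonneg ht (hw b)), blockDeriv]
  set Z := normDeriv (block V b x) (block V b g)
  by_cases hx : block V b x = 0
  · have hb : b ∉ blockSupport V x := fun h => mem_blockSupport.1 h hx
    simp only [hx, hb, if_true, if_false]
    rcases le_total (Z - s * w b) 0 with h1 | h1
    · rw [max_eq_right h1]
      nlinarith [sq_nonneg (max (Z - t * w b) 0)]
    · rw [max_eq_left h1]
      rcases le_total (Z - t * w b) 0 with h2 | h2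
      · rw [max_eq_right h2]
        nlinarith
      · rw [max_eq_left h2]
        nlinarith [sq_nonneg ((t - s) * w b)]
  · have hb : b ∈ blockSupport V x := mem_blockSupport.2 hx
    simp only [hx, hb, if_true, if_false]
    nlinarith [sq_nonneg ((t - s) * w b)]

theorem sum_mul_normDeriv_normResidual {w : Fin q → ℝ} (hw : ∀ b, 0 ≤ w b)
    (x g : EuclideanSpace ℝ (Fin n)) {t : ℝ} (ht : 0 ≤ t) :
    ∑ b, w b * normDeriv (block V b x) (normResidual (block V b x) (block V b g) (t * w b)) =
      dualSlope w (blockSupport V x) (blockDeriv V x g) t := by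
  refine Finset.sum_congr rfl fun b _ => ?_
  rw [normDeriv_normResidual _ _ (mul_nonneg ht (hw b)), blockDeriv]
  by_cases hx : block V b x = 0
  · have hb : b ∉ blockSupport V x := fun h => mem_blockSupport.1 h hx
    simp [hx, hb]
  · have hb : b ∈ blockSupport V x := mem_blockSupport.2 hx
    simp [hx, hb]

/-- Dilating by the mean of the optimal dilation loses at most two: by the tangent line inequality
the loss is twice a covariance of the optimal dilation with the slope. -/
theorem exists_integral_subdiffDistSq_le (hV : IsPartitionOf V) (hk : ∀ b, 0 < (V b).card)
    {w : Fin q → ℝ} (hw : ∀ b, 0 ≤ w b) {x : EuclideanSpace ℝ (Fin n)}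
    (hx : 0 < weightedL12 V w x) :
    ∃ t, 0 ≤ t ∧ ∫ g, subdiffDistSq V w x g t ∂(stdGaussian (EuclideanSpace ℝ (Fin n))) ≤
      statDim (descentCone (weightedL12 V w) x) + 2 := by
  set B := blockSupport V x with hBdef
  have hB : 0 < ∑ b ∈ B, w b ^ 2 := by
    rw [weightedL12_eq] at hx
    obtain ⟨b, -, hb⟩ := Finset.exists_lt_of_sum_lt (s := Finset.univ)
      (f := fun _ : Fin q => (0 : ℝ)) (g := fun b => w b * ‖block V b x‖) (by simpa using hx)
    have hwb : w b ≠ 0 := fun h => by simp [h] at hb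
    have hxb : block V b x ≠ 0 := fun h => by simp [h] at hb
    exact Finset.sum_pos' (fun _ _ => sq_nonneg _) ⟨b, mem_blockSupport.2 hxb, by positivity⟩
  set μ := blockLaw V x
  set γ := stdGaussian (EuclideanSpace ℝ (Fin n))
  set τ := maxLinear (activeCoeff w B)
  have hmp : MeasurePreserving (blockDeriv V x) γ (Measure.pi μ) :=
    measurePreserving_blockDeriv hV x
  have h2 : ∀ b, MemLp (fun y : ℝ => y) 2 (μ b) := memLp_blockLaw x
  have hτ : MemLp τ 2 (Measure.pi μ) := memLp_maxLinear _ h2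
  have hτi : Integrable τ (Measure.pi μ) := hτ.integrable one_le_two
  have hτ0 : ∀ z, 0 ≤ τ z := maxLinear_activeCoeff_nonneg w B
  set t := ∫ z, τ z ∂(Measure.pi μ) with htdef
  have ht : 0 ≤ t := integral_nonneg hτ0
  refine ⟨t, ht, ?_⟩
  set f : Fin q → ℝ → ℝ := fun b y => if b ∈ B then y else max (y - t * w b) 0 with hf
  have hfLp : ∀ b, MemLp (f b) 2 (μ b) := by
    intro b
    by_cases hb : b ∈ B
    · simpa [hf, hb] using h2 b
    · simpa [hf, hb] using memLp_posPart_sub (h2 b) (t * w b)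
  have hcov := integral_sum_mul_maxLinear_sub_le (activeCoeff_nonneg hw B) hw
    (sum_mul_activeCoeff_le w B) h2 hfLp (by
      intro b T K hT hmono
      have hst := steinBound_blockLaw (hk b) x
      by_cases hb : b ∈ B
      · simpa [hf, hb] using hst T K hT hmono
      · simpa [hf, hb] using hst.posPart_sub (h2 b) (t * w b) hT hmono)
  set W := ∑ b ∈ B, w b ^ 2
  have hslope : ∀ z, dualSlope w B z t = (∑ b, w b * f b (z b)) - t * W := by
    intro z
    rw [dualSlope, Finset.mul_sum, ← Finset.univ_inter B, ← Finset.sum_ite_mem,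
      ← Finset.sum_sub_distrib]
    refine Finset.sum_congr rfl fun b _ => ?_
    by_cases hb : b ∈ B
    · simp only [hf, Finset.univ_inter, hb, if_true]
      ring
    · simp [hf, hb]
  have hsumLp : MemLp (fun z : Fin q → ℝ => ∑ b, w b * f b (z b)) 2 (Measure.pi μ) :=
    memLp_finsetSum _ fun b _ =>
      ((hfLp b).comp_measurePreserving (measurePreserving_eval μ b)).const_mul _
  have hτt : MemLp (fun z => τ z - t) 2 (Measure.pi μ) := hτ.sub (memLp_const t)
  have hprod : Integrable (fun z : Fin q → ℝ => (∑ b, w b * f b (z b)) * (τ z - t))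
      (Measure.pi μ) := hsumLp.integrable_mul hτt
  have hcenter : ∫ z, (τ z - t) ∂(Measure.pi μ) = 0 := by
    rw [integral_sub hτi (integrable_const _)]
    simp [htdef]
  have hbound : Integrable (fun z => 2 * ((τ z - t) * dualSlope w B z t)) (Measure.pi μ) ∧
      ∫ z, 2 * ((τ z - t) * dualSlope w B z t) ∂(Measure.pi μ) ≤ 2 := by
    have e : ∀ z, (τ z - t) * dualSlope w B z t =
        (∑ b, w b * f b (z b)) * (τ z - t) - t * W * (τ z - t) := by
      intro z
      rw [hslope]
      ring
    have hi2 := (hτt.integrable one_le_two).const_mul (t * W)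
    simp only [e]
    refine ⟨(hprod.sub hi2).const_mul 2, ?_⟩
    rw [integral_const_mul, integral_sub hprod hi2, integral_const_mul, hcenter]
    linarith
  have hpt : ∀ g, subdiffDistSq V w x g t -
      Metric.infDist g (polarCone (descentCone (weightedL12 V w) x)) ^ 2 ≤
      2 * ((τ (blockDeriv V x g) - t) * dualSlope w B (blockDeriv V x g) t) := by
    intro g
    obtain ⟨hD, htD⟩ := dualSlope_maxLinear hw hB (blockDeriv V x g)
    have hτg := hτ0 (blockDeriv V x g)
    have h1 := subdiffDistSq_sub_le (V := V) hw x g ht hτg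
    rw [← sum_mul_normDeriv_normResidual hw x g hτg] at hD htD
    have h3 := le_infDist_polarCone_sq hV hw hx hτg hD htD
    linarith
  have hFi := integrable_subdiffDistSq hV hk hw x ht
  have hIi := integrable_infDist_polarCone_sq (descentCone (weightedL12 V w) x)
  have h4 := integral_mono (hFi.sub hIi) (hmp.integrable_comp_of_integrable hbound.1) hpt
  rw [integral_sub' hFi hIi] at h4
  have h5 := integral_comp_measurePreserving hmp hbound.1
  have h6 : ∫ g, ((fun z => 2 * ((τ z - t) * dualSlope w B z t)) ∘ blockDeriv V x) g ∂γ ≤ 2 := by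
    simp only [Function.comp_apply]
    rw [h5]
    exact hbound.2
  rw [statDim]
  linarith

/-- If the weighted norm vanishes at `x`, the bound is attained by letting the dilation tend to
infinity. -/
theorem exists_tendsto_integral_subdiffDistSq (hV : IsPartitionOf V) (hk : ∀ b, 0 < (V b).card)
    {w : Fin q → ℝ} (hw : ∀ b, 0 ≤ w b) {x : EuclideanSpace ℝ (Fin n)}
    (hx : weightedL12 V w x = 0) :
    ∃ D ≤ statDim (descentCone (weightedL12 V w) x),
      Filter.Tendsto (fun N : ℕ => ∫ g, subdiffDistSq V w x g N
        ∂(stdGaussian (EuclideanSpace ℝ (Fin n)))) Filter.atTop (nhds D) := by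
  set γ := stdGaussian (EuclideanSpace ℝ (Fin n))
  set F : EuclideanSpace ℝ (Fin n) → ℝ := fun g => ∑ b, if w b = 0 then ‖block V b g‖ ^ 2 else 0
  have hx0 : ∀ b, w b ≠ 0 → block V b x = 0 := by
    intro b hb
    rw [weightedL12_eq, Finset.sum_eq_zero_iff_of_nonneg
      fun b _ => mul_nonneg (hw b) (norm_nonneg _)] at hx
    exact norm_eq_zero.1 ((mul_eq_zero.1 (hx b (Finset.mem_univ b))).resolve_left hb)
  have hzero : ∀ b g, w b = 0 → ∀ N : ℝ,
      ‖normResidual (block V b x) (block V b g) (N * w b)‖ ^ 2 = ‖block V b g‖ ^ 2 := by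
    intro b g hb N
    rw [hb, mul_zero, norm_normResidual_sq _ _ le_rfl]
    split_ifs with hxb
    · simp [hxb, normDeriv]
    · simp
  have hnz : ∀ b g, w b ≠ 0 → ∀ N : ℕ,
      ‖normResidual (block V b x) (block V b g) (N * w b)‖ ^ 2 =
        max (‖block V b g‖ - N * w b) 0 ^ 2 := by
    intro b g hb N
    rw [hx0 b hb, norm_normResidual_zero _ (mul_nonneg N.cast_nonneg (hw b))]
  have hN : Integrable (fun g => ‖g‖ ^ 2) γ :=
    (IsGaussian.memLp_two_id (μ := γ)).norm.integrable_sq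
  have hFmeas : Continuous F := by
    refine continuous_finsetSum _ fun b _ => ?_
    split_ifs
    · exact (continuous_block b).norm.pow 2
    · exact continuous_const
  have hFle : ∀ g, F g ≤ Metric.infDist g (polarCone (descentCone (weightedL12 V w) x)) ^ 2 :=
    fun g => sum_le_infDist_polarCone_sq hV w x g
  have hF0 : ∀ g, 0 ≤ F g := fun g => Finset.sum_nonneg fun b _ => by split_ifs <;> positivity
  have hIi := integrable_infDist_polarCone_sq (descentCone (weightedL12 V w) x)
  have hFi : Integrable F γ := hIi.mono' hFmeas.aestronglyMeasurable
    (Filter.Eventually.of_forall fun g => by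
      rw [Real.norm_of_nonneg (hF0 g)]
      exact hFle g)
  refine ⟨∫ g, F g ∂γ, integral_mono hFi hIi hFle, ?_⟩
  refine tendsto_integral_of_dominated_convergence (fun g => ‖g‖ ^ 2)
    (fun N => (integrable_subdiffDistSq hV hk hw x N.cast_nonneg).aestronglyMeasurable) hN
    (fun N => Filter.Eventually.of_forall fun g => ?_)
    (Filter.Eventually.of_forall fun g => ?_)
  · rw [subdiffDistSq, Real.norm_of_nonneg (Finset.sum_nonneg fun b _ => sq_nonneg _),
      norm_sq_eq_sum_block hV]
    refine Finset.sum_le_sum fun b _ => ?_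
    by_cases hb : w b = 0
    · exact (hzero b g hb N).le
    · rw [hnz b g hb N]
      have h1 : 0 ≤ N * w b := mul_nonneg N.cast_nonneg (hw b)
      exact pow_le_pow_left₀ (le_max_right _ _)
        (max_le (by linarith) (norm_nonneg (block V b g))) 2
  · refine tendsto_finsetSum _ fun b _ => ?_
    by_cases hb : w b = 0
    · simp only [hzero b g hb, if_pos hb]
      exact tendsto_const_nhds
    · rw [if_neg hb]
      have hwb : 0 < w b := lt_of_le_of_ne (hw b) (Ne.symm hb)
      refine tendsto_const_nhds.congr' ?_
      filter_upwards [Filter.eventually_ge_atTop ⌈‖block V b g‖ / w b⌉₊] with N hNle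
      rw [hnz b g hb N, max_eq_right]
      · simp
      · have h1 : ‖block V b g‖ / w b ≤ N := (Nat.le_ceil _).trans (by exact_mod_cast hNle)
        rw [div_le_iff₀ hwb] at h1
        linarith

end Comparison

theorem IsPartitionOf.card_le {α ι : Type*} [Fintype ι] [Fintype α] {P : ι → Finset α}
    (hP : IsPartitionOf P) : Fintype.card ι ≤ Fintype.card α := by
  choose c hc using hP.1
  refine Fintype.card_le_of_injective c fun i j hij => ?_
  by_contra hne
  exact Finset.disjoint_left.1 (hP.2.1 i j hne) (hc i) (hij ▸ hc j)

end BlockSparse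

theorem mainTheorem10 (n q k L : ℕ) (hq : 0 < q)
    (V : Fin q → Finset (Fin n)) (hV : BlockSparse.IsPartitionOf V)
    (hk : ∀ b, (V b).card = k)
    (P : Fin L → Finset (Fin q)) (hP : BlockSparse.IsPartitionOf P)
    (ω : Fin L → ℝ) (hω : ∀ i, 0 ≤ ω i)
    (x : EuclideanSpace ℝ (Fin n)) :
    BlockSparse.mHat k ω (BlockSparse.relativeSize P)
          (BlockSparse.accuracy P (BlockSparse.blockSupport V x))
        - 2 / Real.sqrt ((q : ℝ) * (L : ℝ))
      ≤ BlockSparse.measurementNumber V (BlockSparse.blockWeights P ω) x ∧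
    BlockSparse.measurementNumber V (BlockSparse.blockWeights P ω) x
      ≤ BlockSparse.mHat k ω (BlockSparse.relativeSize P)
          (BlockSparse.accuracy P (BlockSparse.blockSupport V x)) := by
  have hVpos : ∀ b, 0 < (V b).card := fun b => Finset.card_pos.2 (hV.1 b)
  have hk0 : 0 < k := hk ⟨0, hq⟩ ▸ hVpos ⟨0, hq⟩
  have hq' : (0 : ℝ) < q := by exact_mod_cast hq
  set w := BlockSparse.blockWeights P ω with hwdef
  have hw : ∀ b, 0 ≤ w b := BlockSparse.blockWeights_nonneg P hω
  set ρ := BlockSparse.relativeSize P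
  set α := BlockSparse.accuracy P (BlockSparse.blockSupport V x)
  set δ := BlockSparse.statDim (BlockSparse.descentCone (BlockSparse.weightedL12 V w) x) with hδ
  have hPsi : ∀ t : ℝ, 0 ≤ t → BlockSparse.Psi k ω ρ α t =
      (∫ g, BlockSparse.subdiffDistSq V w x g t
        ∂(ProbabilityTheory.stdGaussian (EuclideanSpace ℝ (Fin n)))) / q := by
    intro t ht
    rw [BlockSparse.integral_subdiffDistSq hq hV hk hk0 hP hω x ht]
    exact (mul_div_cancel_left₀ _ hq'.ne').symm
  have hPsi0 : ∀ t : ℝ, 0 ≤ t → 0 ≤ BlockSparse.Psi k ω ρ α t := by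
    intro t ht
    rw [hPsi t ht]
    exact div_nonneg (integral_nonneg fun g => Finset.sum_nonneg fun b _ => sq_nonneg _) hq'.le
  have hmHat : ∀ t : ℝ, 0 ≤ t → BlockSparse.mHat k ω ρ α ≤ BlockSparse.Psi k ω ρ α t := by
    intro t ht
    exact ciInf_le (f := fun t : {t : ℝ // 0 ≤ t} => BlockSparse.Psi k ω ρ α t)
      ⟨0, by rintro _ ⟨s, rfl⟩; exact hPsi0 s s.2⟩ ⟨t, ht⟩
  refine ⟨?_, ?_⟩
  · have hL : 0 < L := by
      obtain ⟨i, -⟩ := hP.2.2 ⟨0, hq⟩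
      exact i.pos
    have hLq : (L : ℝ) ≤ q := by
      have := hP.card_le
      simp only [Fintype.card_fin] at this
      exact_mod_cast this
    have hL' : (0 : ℝ) < L := by exact_mod_cast hL
    have hsqrt : Real.sqrt ((q : ℝ) * L) ≤ q :=
      Real.sqrt_le_iff.2 ⟨hq'.le, by nlinarith⟩
    have hgap : 2 / (q : ℝ) ≤ 2 / Real.sqrt ((q : ℝ) * L) :=
      div_le_div_of_nonneg_left (by norm_num) (Real.sqrt_pos.2 (mul_pos hq' hL')) hsqrt
    suffices h : BlockSparse.mHat k ω ρ α ≤ δ / q + 2 / q by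
      rw [BlockSparse.measurementNumber, ← hδ]
      linarith
    rcases (Finset.sum_nonneg fun b _ => mul_nonneg (hw b) (Real.sqrt_nonneg _) :
      0 ≤ BlockSparse.weightedL12 V w x).eq_or_lt with hx | hx
    · obtain ⟨D, hD, hlim⟩ := BlockSparse.exists_tendsto_integral_subdiffDistSq hV hVpos hw hx.symm
      have h1 : BlockSparse.mHat k ω ρ α ≤ D / q :=
        ge_of_tendsto' (hlim.div_const (q : ℝ)) fun N => by
          rw [← hPsi N N.cast_nonneg]
          exact hmHat N N.cast_nonneg
      have h2 : D / q ≤ δ / q := div_le_div_of_nonneg_right hD hq'.le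
      have h3 : 0 ≤ 2 / (q : ℝ) := by positivity
      linarith
    · obtain ⟨t, ht, hle⟩ := BlockSparse.exists_integral_subdiffDistSq_le hV hVpos hw hx
      refine (hmHat t ht).trans ?_
      rw [hPsi t ht, ← add_div]
      exact div_le_div_of_nonneg_right hle hq'.le
  · have : Nonempty {t : ℝ // 0 ≤ t} := ⟨⟨0, le_rfl⟩⟩
    refine le_ciInf fun t => ?_
    rw [hPsi t t.2, BlockSparse.measurementNumber]
    exact div_le_div_of_nonneg_right (BlockSparse.statDim_le hV hVpos hw x t.2) hq'.le
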